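/- Let $\mathbb{K}$ be an algebraically closed field of characteristic $0$. A multiprojective space is a product $Y=\mathbb{P}^{n_1}\times\cdots\times\mathbb{P}^{n_k}$ over $\mathbb{K}$ with $k\ge 1$ and all $n_i\ge 1$. For a finite set $S\subset Y$ let $(2S,Y)=\bigcup_{p\in S}(2p,Y)$, where $(2p,Y)$ is the closed subscheme of $Y$ with ideal sheaf $(\mathcal{I}_{p,Y})^2$, and let $$\delta(2S,Y):=h^1\bigl(Y,\mathcal{I}_{(2S,Y)}(1,\dots,1)\bigr)$$ be the Terracini defect of $S$ in $Y$. For $r\ge 1$ let $\mathbb{T}_1(Y,r)$ be the set of all $S\subset Y$ with $\#S=r$, $h^0\bigl(Y,\mathcal{I}_{(2S,Y)}(1,\dots,1)\bigr)>0$ and $\delta(2S,Y)>0$. Let $\mathcal{E}(n,r)$ be the set of all pairs $(Y,S)$ where $Y$ is a multiprojective space with $\dim Y=n$ and $S\in\mathbb{T}_1(Y,r)$, and let $$\delta_1(n,r):=\max\{\delta(2S,Y)\;:\;(Y,S)\in\mathcal{E}(n,r)\}.$$ Theorem. Let $n\ge 3$ and $r\ge 2$ be integers. Then the maximum $\delta_1(n,r)$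 exists and $$\delta_1(n,r)=(r-1)(n+1)-1.$$ Moreover, if $(Y,S)\in\mathcal{E}(n,r)$ and $\delta(2S,Y)=\delta_1(n,r)$, then, up to the order of the two factors, $Y=\mathbb{P}^{n-1}\times\mathbb{P}^1$, and there are a line $L\subset\mathbb{P}^{n-1}$ and a point $o\in\mathbb{P}^1$ such that $S\subset L\times\{o\}$ and the projection of $S$ to $\mathbb{P}^{n-1}$ spans $L$. -/

import Mathlib

universe u

noncomputable section

namespace Terracini

section Multiprojective

variable (K : Type u) [Field K] {k : ℕ} (dims : Fin k → ℕ)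

/-- The coordinates `x_{i,j}`, `0 ≤ j ≤ n_i`, on the multiprojective space
`Y = ℙ^{n_1} × ⋯ × ℙ^{n_k}`. -/
abbrev Coord : Type := Σ i : Fin k, Fin (dims i + 1)

/-- The (closed) points of `Y = ℙ^{n_1} × ⋯ × ℙ^{n_k}`. -/
abbrev Points : Type u := ∀ i : Fin k, Projectivization K (Fin (dims i + 1) → K)

/-- The multihomogeneous coordinate ring `K[x_{i,j}]` of `Y`, graded by `ℕ^k`. -/
abbrev CoordRing : Type u := MvPolynomial (Coord dims) K

/-- The fraction field of the multihomogeneous coordinate ring. As `Y` is integral, the sections of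
all subsheaves of `𝒪_Y(d)` over nonempty open sets live in it, and restrictions are inclusions. -/
abbrev Frac : Type u := FractionRing (CoordRing K dims)

variable {dims}

/-- The multidegree of the coordinate `x_{i,j}`: the `i`-th unit vector of `ℕ^k`. -/
def multidegree (c : Coord dims) : Fin k → ℕ := Pi.single c.1 1

variable {K}

/-- The affine cone over the point `p`: all tuples whose `i`-th block lies on the line `p_i`. -/
def cone (p : Points K dims) : Set (Coord dims → K) :=
  {x | ∀ i, (fun j => x ⟨i, j⟩) ∈ (p i).submodule}

/-- The multihomogeneous prime ideal of the point `p`. -/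
def pointIdeal (p : Points K dims) : Ideal (CoordRing K dims) :=
  MvPolynomial.vanishingIdeal K (cone p)

/-- The multihomogeneous ideal of `(2S, Y)`, the union over `p ∈ S` of the closed subschemes with
ideal sheaf `(𝓘_{p,Y})²`. -/
def doublePointsIdeal (S : Finset (Points K dims)) : Ideal (CoordRing K dims) :=
  ⨅ p ∈ S, pointIdeal p ^ 2

variable (dims)

/-- The standard affine charts `U_a = {x_{1,a_1} ≠ 0, …, x_{k,a_k} ≠ 0}` of `Y`. -/
abbrev Chart : Type := ∀ i : Fin k, Fin (dims i + 1)

variable {dims} (K)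

/-- The monomial whose nonvanishing locus is `U_{t_1} ∩ ⋯ ∩ U_{t_q}`; its multidegree is
`(q, …, q)`. -/
def chartMonomial {q : ℕ} (t : Fin q → Chart dims) : CoordRing K dims :=
  ∏ l, ∏ i, MvPolynomial.X ⟨i, t l i⟩

theorem chartMonomial_pow_isWeightedHomogeneous {q : ℕ} (t : Fin q → Chart dims) (N : ℕ) :
    MvPolynomial.IsWeightedHomogeneous multidegree (chartMonomial K t ^ N)
      (fun _ => N * q) := by
  have h : MvPolynomial.IsWeightedHomogeneous multidegree (chartMonomial K t)
      (∑ _l : Fin q, ∑ i : Fin k, Pi.single i 1) :=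
    MvPolynomial.IsWeightedHomogeneous.prod _ _ _ fun l _ =>
      MvPolynomial.IsWeightedHomogeneous.prod _ _ _ fun i _ =>
        MvPolynomial.isWeightedHomogeneous_X K multidegree (⟨i, t l i⟩ : Coord dims)
  have h' := h.pow N
  convert h' using 1
  ext i
  simp [Finset.sum_apply, Pi.single_apply]

variable {K}

/-- For a multihomogeneous ideal `J` with associated ideal sheaf `𝓙`, the space of sections of
`𝓙(d)` over `U_{t_1} ∩ ⋯ ∩ U_{t_q}`: the fractions `g / m ^ N` of multidegree `d`, with `g ∈ J`
multihomogeneous and `m` the monomial of `t`. -/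
def chartSections (J : Ideal (CoordRing K dims)) (d : Fin k → ℕ) {q : ℕ}
    (t : Fin q → Chart dims) : Submodule K (Frac K dims) where
  carrier := {f | ∃ (N : ℕ) (g : CoordRing K dims), g ∈ J ∧
    MvPolynomial.IsWeightedHomogeneous multidegree g (fun i => d i + N * q) ∧
    f * algebraMap (CoordRing K dims) (Frac K dims) (chartMonomial K t ^ N) =
      algebraMap (CoordRing K dims) (Frac K dims) g}
  zero_mem' := ⟨0, 0, J.zero_mem, MvPolynomial.isWeightedHomogeneous_zero _ _ _, by simp⟩
  add_mem' := by
    rintro f f' ⟨N, g, hg, hd, he⟩ ⟨N', g', hg', hd', he'⟩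
    refine ⟨N + N', g * chartMonomial K t ^ N' + g' * chartMonomial K t ^ N,
      J.add_mem (J.mul_mem_right _ hg) (J.mul_mem_right _ hg'), ?_, ?_⟩
    · refine MvPolynomial.IsWeightedHomogeneous.add ?_ ?_
      · convert hd.mul (chartMonomial_pow_isWeightedHomogeneous K t N') using 1
        funext i
        simp only [Pi.add_apply]
        ring
      · convert hd'.mul (chartMonomial_pow_isWeightedHomogeneous K t N) using 1
        funext i
        simp only [Pi.add_apply]
        ring
    · rw [map_add, map_mul, map_mul, ← he, ← he', pow_add, map_mul]
      ring
  smul_mem' := by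
    rintro a f ⟨N, g, hg, hd, he⟩
    refine ⟨N, MvPolynomial.C a * g, J.mul_mem_left _ hg, ?_, ?_⟩
    · simpa using (MvPolynomial.isWeightedHomogeneous_C multidegree a).mul hd
    · rw [map_mul, ← he, ← MvPolynomial.algebraMap_eq, ← IsScalarTower.algebraMap_apply,
        Algebra.smul_def, mul_assoc]

/-- The Čech `q`-cochains of `𝓙(d)` for the cover of `Y` by the standard affine charts. -/
def cochains (J : Ideal (CoordRing K dims)) (d : Fin k → ℕ) (q : ℕ) :
    Submodule K ((Fin (q + 1) → Chart dims) → Frac K dims) :=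
  Submodule.pi Set.univ (fun t => chartSections J d t)

variable (K dims)

/-- The Čech differential `(∂c)_{t_0 … t_{q+1}} = ∑_l (-1)^l c_{t_0 … t̂_l … t_{q+1}}`. -/
def cechDiff (q : ℕ) : ((Fin (q + 1) → Chart dims) → Frac K dims) →ₗ[K]
    ((Fin (q + 2) → Chart dims) → Frac K dims) :=
  LinearMap.pi fun t => ∑ l : Fin (q + 2), (-1 : K) ^ (l : ℕ) •
    LinearMap.proj (fun s => t (l.succAbove s))

variable {K dims}

/-- Čech cocycles of `𝓙(d)`. -/
def cocycles (J : Ideal (CoordRing K dims)) (d : Fin k → ℕ) (q : ℕ) :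
    Submodule K ((Fin (q + 1) → Chart dims) → Frac K dims) :=
  cochains J d q ⊓ LinearMap.ker (cechDiff K dims q)

/-- Čech coboundaries of `𝓙(d)`. -/
def coboundaries (J : Ideal (CoordRing K dims)) (d : Fin k → ℕ) : (q : ℕ) →
    Submodule K ((Fin (q + 1) → Chart dims) → Frac K dims)
  | 0 => ⊥
  | q + 1 => (cochains J d q).map (cechDiff K dims q)

/-- The cohomology group `H^q(Y, 𝓙(d))`, computed by the Čech complex of the standard affine
cover. -/
abbrev Cohomology (J : Ideal (CoordRing K dims)) (d : Fin k → ℕ) (q : ℕ) : Type u :=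
  cocycles J d q ⧸ (coboundaries J d q).submoduleOf (cocycles J d q)

/-- `h^q(Y, 𝓙(d)) = dim_K H^q(Y, 𝓙(d))`. -/
def h (q : ℕ) (J : Ideal (CoordRing K dims)) (d : Fin k → ℕ) : ℕ :=
  Module.finrank K (Cohomology J d q)

/-- The Terracini defect `δ(2S, Y) = h¹(𝓘_{(2S,Y)}(1, …, 1))`. -/
def defect (S : Finset (Points K dims)) : ℕ :=
  h 1 (doublePointsIdeal S) (fun _ => 1)

variable (K dims)

/-- `𝕋₁(Y, r)`: the sets `S` of `r` points of `Y` with `h⁰(𝓘_{(2S,Y)}(1, …, 1)) > 0` and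
`δ(2S, Y) > 0`. -/
def T₁ (r : ℕ) : Set (Finset (Points K dims)) :=
  {S | S.card = r ∧ 0 < h 0 (doublePointsIdeal S) (fun _ => 1) ∧ 0 < defect S}

end Multiprojective

section Maximum

variable (K : Type u) [Field K]

/-- A pair `(Y, S)`: a multiprojective space `Y = ℙ^{n_1} × ⋯ × ℙ^{n_k}` with all `n_i > 0`, and a
finite set `S` of points of `Y`. -/
structure Pair where
  k : ℕ
  k_pos : 0 < k
  dims : Fin k → ℕ
  dims_pos : ∀ i, 0 < dims i
  S : Finset (Points K dims)

/-- The set `𝓔(n, r)` of pairs `(Y, S)` with `dim Y = n` and `S ∈ 𝕋₁(Y, r)`. -/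
def E (n r : ℕ) : Set (Pair K) :=
  {P | ∑ i, P.dims i = n ∧ P.S ∈ T₁ K P.dims r}

/-- The defects `δ(2S, Y)` of the pairs `(Y, S) ∈ 𝓔(n, r)`. -/
def defects (n r : ℕ) : Set ℕ := {δ | ∃ P ∈ E K n r, defect P.S = δ}

/-- `δ₁(n, r)`, the maximum of the defects `δ(2S, Y)` over `(Y, S) ∈ 𝓔(n, r)`. -/
def δ₁ (n r : ℕ) : ℕ := sSup (defects K n r)

variable {K}

/-- Up to the order of the two factors, `Y = ℙ^{n-1} × ℙ^1`, and `S ⊆ L × {o}` for a point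
`o ∈ ℙ^1` and a linear subspace `L ⊆ ℙ^{n-1}` of dimension `μ` that is spanned by the projection
of `S`. A linear subspace is given by the vector subspace of dimension `μ + 1` below it. -/
def IsLinearExample (n μ : ℕ) (P : Pair K) : Prop :=
  P.k = 2 ∧ ∃ i j : Fin P.k, i ≠ j ∧ P.dims i = n - 1 ∧ P.dims j = 1 ∧
    ∃ (L : Submodule K (Fin (P.dims i + 1) → K))
      (o : Projectivization K (Fin (P.dims j + 1) → K)),
      Module.finrank K L = μ + 1 ∧
      (∀ p ∈ P.S, (p i).submodule ≤ L ∧ p j = o) ∧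
      ⨆ p ∈ P.S, (p i).submodule = L

end Maximum

end Terracini

end

/-! The sequence `0 → 𝓘_{2S}(1,…,1) → 𝒪(1,…,1) → 𝒪_{2S}(1,…,1) → 0` and `H¹(𝒪(1,…,1)) = 0` turn the
defect into linear algebra. If `ρ` is the rank of the map sending a multilinear form to its first
order jets at the points of `S`, then `δ + ρ = r(n+1)` (`defect_add_finrank_range`), while `h⁰` is
the dimension of the kernel (`h_zero_eq`). Maximizing `δ` therefore means minimizing `ρ`, and the
claim becomes `ρ ≥ n+2`, with equality only for collinear points in a slice `ℙ^{n-1} × {o}`.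

One double point always imposes `n+1` conditions, so `h⁰ > 0` forces at least two factors
(`two_le_of_h_zero_pos`). Every further condition comes from forms singular at `p` with independent
jets elsewhere in `S` (`add_le_finrank_range`). Such forms are products of linear forms, one per
factor, two of which vanish at `p`. For `q ≠ p` there is always one with nonzero jet at `q`, and
there are two independent ones unless `Y` has two factors and `p`, `q` share their coordinate in a
factor `ℙ¹` (`le_finrank_range`). In that case a third point off the line through the projections of
`p` and `q` supplies a second form (`le_finrank_range_of_notMem`). So `ρ = n+2` forces the asserted
shape.

Conversely, for points of `L × {o}` in `ℙ^{n-1} × ℙ¹` there are `n-2` independent products of an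
equation of `L` with the equation of `o`, all singular on `S`. Hence `ρ ≤ 2n - (n-2) = n+2`, so the
bound is attained (`mem_defects`). -/

noncomputable section

namespace Terracini

open MvPolynomial

/-! ### Multihomogeneous polynomials: rescaling, Euler identities, Taylor expansion. -/

section Homogeneous

variable {K : Type u} [Field K] {k : ℕ} {dims : Fin k → ℕ}

theorem weight_multidegree (e : Coord dims →₀ ℕ) (i : Fin k) :
    Finsupp.weight (multidegree (dims := dims)) e i = ∑ j, e ⟨i, j⟩ := by
  rw [Finsupp.weight_apply, Finsupp.sum_fintype _ _ (by simp), Finset.sum_apply,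
    Fintype.sum_sigma, Finset.sum_eq_single i]
  · simp [multidegree]
  · intro b _ hb
    simp [multidegree, hb.symm]
  · simp

theorem isWeightedHomogeneous_iff {G : CoordRing K dims} {d : Fin k → ℕ} :
    IsWeightedHomogeneous multidegree G d ↔
      ∀ e ∈ G.support, ∀ i, ∑ j, e ⟨i, j⟩ = d i := by
  constructor
  · intro h e he i
    rw [← weight_multidegree, h (mem_support_iff.1 he)]
  · intro h e he
    funext i
    rw [weight_multidegree, h e (mem_support_iff.2 he)]

/-- Rescaling the blocks of variables in a multihomogeneous polynomial. -/
theorem IsWeightedHomogeneous.aeval_mul {A : Type*} [CommRing A] [Algebra K A]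
    {G : CoordRing K dims} {d : Fin k → ℕ} (hG : IsWeightedHomogeneous multidegree G d)
    (u : Fin k → A) (y : Coord dims → A) :
    aeval (fun c => u c.1 * y c) G = (∏ i, u i ^ d i) * aeval y G := by
  rw [aeval_def, aeval_def, eval₂_eq', eval₂_eq', Finset.mul_sum]
  refine Finset.sum_congr rfl fun e he => ?_
  have h := isWeightedHomogeneous_iff.1 hG e he
  simp_rw [mul_pow, Finset.prod_mul_distrib]
  have : ∏ c : Coord dims, u c.1 ^ e c = ∏ i, u i ^ d i := by
    rw [Fintype.prod_sigma]
    refine Finset.prod_congr rfl fun i _ => ?_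
    rw [← h i]
    exact Finset.prod_pow_eq_pow_sum Finset.univ (fun j => e ⟨i, j⟩) (u i)
  rw [this]
  ring

theorem euler_block {G : CoordRing K dims} {d : Fin k → ℕ}
    (hG : IsWeightedHomogeneous multidegree G d) (i : Fin k) :
    ∑ j, X ⟨i, j⟩ * pderiv (⟨i, j⟩ : Coord dims) G = (d i : CoordRing K dims) * G := by
  have h : IsWeightedHomogeneous (fun c : Coord dims => (multidegree c i : ℕ)) G (d i) := by
    intro e he
    rw [← hG he, Finsupp.weight_apply, Finsupp.weight_apply, Finsupp.sum_fintype _ _ (by simp),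
      Finsupp.sum_fintype _ _ (by simp), Finset.sum_apply]
    simp
  have h2 := h.sum_weight_X_mul_pderiv
  rw [Fintype.sum_sigma, Finset.sum_eq_single i] at h2
  · simpa [multidegree] using h2
  · intro b _ hb
    simp [multidegree, hb.symm]
  · simp

/-- First order Taylor expansion modulo the square of an ideal. -/
theorem taylor_mod_sq {A σ : Type*} [CommRing A] [Algebra K A] [Fintype σ] (I : Ideal A)
    (b y : σ → A) (hy : ∀ c, y c ∈ I) (G : MvPolynomial σ K) :
    aeval (fun c => b c + y c) G - (aeval b G + ∑ c, y c * aeval b (pderiv c G)) ∈ I ^ 2 := by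
  classical
  induction G using MvPolynomial.induction_on with
  | C a => simp
  | add p q hp hq =>
    have := add_mem hp hq
    convert this using 1
    simp only [map_add, mul_add, Finset.sum_add_distrib]
    ring
  | mul_X p c hp =>
    have hs : ∑ x, y x * aeval b (pderiv x p) ∈ I :=
      I.sum_mem fun x _ => I.mul_mem_right _ (hy x)
    have h1 : (∑ x, y x * aeval b (pderiv x p)) * y c ∈ I ^ 2 := by
      rw [pow_two]; exact Ideal.mul_mem_mul hs (hy c)
    have h2 := (I ^ 2).mul_mem_right (b c + y c) hp
    have h3 : ∑ x, y x * aeval b (pderiv x (p * X c)) =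
        (∑ x, y x * aeval b (pderiv x p)) * b c + y c * aeval b p := by
      have : ∀ x, y x * aeval b (pderiv x (p * X c)) =
          y x * aeval b (pderiv x p) * b c + if x = c then y c * aeval b p else 0 := by
        intro x
        rw [Derivation.leibniz, pderiv_X, Pi.single_apply]
        simp only [smul_eq_mul, map_add, map_mul, aeval_X]
        by_cases hx : x = c
        · subst hx; simp; ring
        · have hx' : ¬ c = x := fun h => hx h.symm
          simp [hx, hx']; ring
      simp_rw [this, Finset.sum_add_distrib, Finset.sum_ite_eq' Finset.univ c, Finset.sum_mul]
      simp
    convert add_mem h2 h1 using 1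
    rw [h3]
    simp only [map_mul, aeval_X]
    ring

end Homogeneous

/-! ### First order jets of polynomials and of rational functions. -/

section Jets

variable (K : Type u) [Field K] {k : ℕ} (dims : Fin k → ℕ)

/-- First order jets of functions at a point of the affine space of all coordinates: a value
together with a gradient. -/
abbrev Jet : Type u := TrivSqZeroExt K (Coord dims → K)

variable {K dims}

/-- The first order jet at `v` of a polynomial. -/
def jet (v : Coord dims → K) : CoordRing K dims →ₐ[K] Jet K dims :=
  aeval fun c => TrivSqZeroExt.inl (v c) + TrivSqZeroExt.inr (Pi.single c 1)

theorem fst_jet (v : Coord dims → K) (G : CoordRing K dims) : (jet v G).fst = eval v G := by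
  induction G using MvPolynomial.induction_on with
  | C a => simp [jet, TrivSqZeroExt.algebraMap_eq_inl]
  | add p q hp hq => simp [hp, hq]
  | mul_X p c hp => rw [map_mul, TrivSqZeroExt.fst_mul, hp]; simp [jet]

theorem snd_jet (v : Coord dims → K) (G : CoordRing K dims) (c : Coord dims) :
    (jet v G).snd c = eval v (pderiv c G) := by
  induction G using MvPolynomial.induction_on with
  | C a => simp [jet, TrivSqZeroExt.algebraMap_eq_inl]
  | add p q hp hq => simp [hp, hq]
  | mul_X p x hp =>
    have hX : jet v (X x : CoordRing K dims) =
        TrivSqZeroExt.inl (v x) + TrivSqZeroExt.inr (Pi.single x 1) := by simp [jet]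
    rw [map_mul, TrivSqZeroExt.snd_mul, Derivation.leibniz, fst_jet, hX, pderiv_X]
    by_cases hx : c = x
    · subst hx
      simp [hp]
    · simp [hp, hx, Ne.symm hx]

theorem isUnit_jet {v : Coord dims → K} {G : CoordRing K dims} (h : eval v G ≠ 0) :
    IsUnit (jet v G) := by
  rw [TrivSqZeroExt.isUnit_iff_isUnit_fst, fst_jet]
  exact h.isUnit

theorem jet_sq_eq_zero {v : Coord dims → K} {G : CoordRing K dims} (h : eval v G = 0) :
    jet v (G ^ 2) = 0 := by
  rw [map_pow, pow_two]
  ext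
  · simp [fst_jet, h]
  · simp [fst_jet, h]

/-- Jets of polynomials not vanishing at `v` are units, so the jet map factors through the local
ring at `v`. The extension to non-regular fractions is an arbitrary linear one; it only serves to
make the jet a total linear map on the fraction field. -/
theorem exists_jet_extension (v : Coord dims → K) :
    ∃ J : Frac K dims →ₗ[K] Jet K dims, ∀ (f : Frac K dims) (g m : CoordRing K dims),
      eval v m ≠ 0 → f * algebraMap _ _ m = algebraMap _ _ g → J f * jet v m = jet v g := by
  let P : Ideal (CoordRing K dims) := RingHom.ker (eval v)
  have : P.IsPrime := RingHom.ker_isPrime _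
  have hP : P.primeCompl ≤ nonZeroDivisors (CoordRing K dims) := P.primeCompl_le_nonZeroDivisors
  let B : Subalgebra (CoordRing K dims) (Frac K dims) :=
    Localization.subalgebra.ofField (Frac K dims) P.primeCompl hP
  have : IsLocalization P.primeCompl B := Localization.subalgebra.isLocalization_ofField _ _ hP
  have hu : ∀ y : P.primeCompl, IsUnit ((jet v : CoordRing K dims →+* Jet K dims) y) := by
    rintro ⟨y, hy⟩
    exact isUnit_jet (by simpa [P] using hy)
  let φ : B →+* Jet K dims := IsLocalization.lift hu
  have hφ : ∀ g : CoordRing K dims, φ (algebraMap _ _ g) = jet v g := fun g =>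
    IsLocalization.lift_eq hu g
  let B' : Submodule K (Frac K dims) := (B.restrictScalars K).toSubmodule
  let ψ : B' →ₗ[K] Jet K dims :=
    { toFun := fun x => φ ⟨x.1, x.2⟩
      map_add' := fun x y => φ.map_add ⟨x.1, x.2⟩ ⟨y.1, y.2⟩
      map_smul' := fun a x => by
        have h1 : (⟨(a • x).1, (a • x).2⟩ : B) = algebraMap (CoordRing K dims) B (C a) * ⟨x.1, x.2⟩ := by
          apply Subtype.ext
          change a • x.1 = algebraMap (CoordRing K dims) (Frac K dims) (C a) * x.1
          rw [← MvPolynomial.algebraMap_eq, ← IsScalarTower.algebraMap_apply, Algebra.smul_def]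
        rw [h1, map_mul, hφ, ← MvPolynomial.algebraMap_eq, AlgHom.commutes, RingHom.id_apply,
          Algebra.smul_def] }
  obtain ⟨J, hJ⟩ := ψ.exists_extend
  refine ⟨J, fun f g m hm hf => ?_⟩
  have hmP : m ∈ P.primeCompl := by simpa [P] using hm
  have hm0 : algebraMap (CoordRing K dims) (Frac K dims) m ≠ 0 := by
    rw [Ne, FaithfulSMul.algebraMap_eq_zero_iff]
    rintro rfl
    simp at hm
  let x : B := IsLocalization.mk' B g ⟨m, hmP⟩
  have hx : x * algebraMap _ B m = algebraMap _ B g := IsLocalization.mk'_spec B g ⟨m, hmP⟩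
  have hxf : (x : Frac K dims) = f := by
    have := congrArg (Subtype.val) hx
    change (x : Frac K dims) * algebraMap _ _ m = algebraMap _ _ g at this
    exact mul_right_cancel₀ hm0 (this.trans hf.symm)
  have hfB : f ∈ B' := by rw [← hxf]; exact x.2
  have hJf : J f = φ x := by
    have := LinearMap.congr_fun hJ ⟨f, hfB⟩
    simp only [LinearMap.comp_apply, Submodule.subtype_apply] at this
    rw [this]
    change φ ⟨f, hfB⟩ = φ x
    congr 1
    exact Subtype.ext hxf.symm
  rw [hJf, ← hφ m, ← map_mul, hx, hφ]

end Jets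

/-! ### Squares of point ideals, detected by jets. -/

section PointIdeal

variable {K : Type u} [Field K] {k : ℕ} {dims : Fin k → ℕ}

/-- Multihomogeneous coordinates of a point. -/
def rep (p : Points K dims) : Coord dims → K := fun c => (p c.1).rep c.2

theorem exists_rep_ne_zero (p : Points K dims) (i : Fin k) : ∃ j, rep p ⟨i, j⟩ ≠ 0 := by
  by_contra! h
  exact (p i).rep_nonzero (funext h)

theorem mem_cone_iff {p : Points K dims} {x : Coord dims → K} :
    x ∈ cone p ↔ ∀ i, ∃ a : K, ∀ j, x ⟨i, j⟩ = a * rep p ⟨i, j⟩ := by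
  refine forall_congr' fun i => ?_
  rw [Projectivization.submodule_eq, Submodule.mem_span_singleton]
  refine exists_congr fun a => ?_
  rw [funext_iff]
  exact forall_congr' fun j => eq_comm

theorem eval_rep_eq_zero {p : Points K dims} {G : CoordRing K dims} (h : G ∈ pointIdeal p) :
    eval (rep p) G = 0 :=
  h (rep p) (mem_cone_iff.2 fun _ => ⟨1, fun _ => (one_mul _).symm⟩)

theorem jet_eq_zero_of_mem {p : Points K dims} {G : CoordRing K dims}
    (h : G ∈ pointIdeal p ^ 2) : jet (rep p) G = 0 := by
  rw [pow_two] at h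
  refine Submodule.mul_induction_on h (fun a ha b hb => ?_) (fun a b ha hb => ?_)
  · rw [map_mul]
    ext
    · simp [fst_jet, eval_rep_eq_zero ha]
    · simp [fst_jet, eval_rep_eq_zero ha, eval_rep_eq_zero hb]
  · rw [map_add, ha, hb, add_zero]

theorem X_mem_pointIdeal {p : Points K dims} {c : Coord dims} (h : rep p c = 0) :
    (X c : CoordRing K dims) ∈ pointIdeal p := by
  intro x hx
  obtain ⟨a, ha⟩ := mem_cone_iff.1 hx c.1
  rw [aeval_X]
  exact (ha c.2).trans (by rw [show rep p ⟨c.1, c.2⟩ = 0 from h, mul_zero])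

theorem chartMonomial_mem_pointIdeal {p : Points K dims} {q : ℕ} {t : Fin q → Chart dims}
    (h : eval (rep p) (chartMonomial K t) = 0) : chartMonomial K t ∈ pointIdeal p := by
  simp only [chartMonomial, map_prod, eval_X, Finset.prod_eq_zero_iff, Finset.mem_univ,
    true_and] at h
  obtain ⟨l, i, h⟩ := h
  exact Ideal.mem_of_dvd _ ((Finset.dvd_prod_of_mem _ (Finset.mem_univ i)).trans
    (Finset.dvd_prod_of_mem _ (Finset.mem_univ l))) (X_mem_pointIdeal h)

/-- Expand `G` around the projection onto the cone of `p`. By multihomogeneity its value and partial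
derivatives along the cone are multiples of those at `rep p`, which vanish, and the remainder is in
the square of the ideal. Writing the degree as `d i + 1` keeps the degrees of the partial
derivatives free of subtraction. -/
theorem mem_pointIdeal_sq {p : Points K dims} {G : CoordRing K dims} {d : Fin k → ℕ}
    (hG : IsWeightedHomogeneous multidegree G (fun i => d i + 1)) (h : jet (rep p) G = 0) :
    G ∈ pointIdeal p ^ 2 := by
  choose a ha using exists_rep_ne_zero p
  -- `b` is a linear retraction onto the cone: block `i` is replaced by the multiple of `rep p` with
  -- the same `a i`-th coordinate. Hence `y = X - b` vanishes on the cone.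
  let u : Fin k → CoordRing K dims := fun i => C (rep p ⟨i, a i⟩)⁻¹ * X ⟨i, a i⟩
  let b : Coord dims → CoordRing K dims := fun c => u c.1 * C (rep p c)
  let y : Coord dims → CoordRing K dims := fun c => X c - b c
  have hy : ∀ c, y c ∈ pointIdeal p := by
    rintro ⟨i, j⟩ x hx
    obtain ⟨l, hl⟩ := mem_cone_iff.1 hx i
    have := ha i
    simp only [y, b, u, map_sub, map_mul, aeval_X, aeval_C, hl, Algebra.algebraMap_self,
      RingHom.id_apply]
    field_simp
    ring
  have hC : ∀ F : CoordRing K dims, aeval (fun c => (C (rep p c) : CoordRing K dims)) F =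
      C (eval (rep p) F) := fun F => aeval_algebraMap_apply (CoordRing K dims) (rep p) F
  have hb : aeval b G = 0 := by
    have h0 : eval (rep p) G = 0 := by rw [← fst_jet, h]; rfl
    rw [show b = fun c => u c.1 * C (rep p c) from rfl, IsWeightedHomogeneous.aeval_mul hG, hC, h0]
    simp
  have hb' : ∀ c, aeval b (pderiv c G) = 0 := by
    intro c
    have h0 : eval (rep p) (pderiv c G) = 0 := by rw [← snd_jet, h]; rfl
    have hd : IsWeightedHomogeneous multidegree (pderiv c G)
        (fun i => d i + if i = c.1 then 0 else 1) := by
      refine hG.pderiv ?_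
      funext i
      by_cases hi : i = c.1 <;> simp [multidegree, hi]
    rw [show b = fun c => u c.1 * C (rep p c) from rfl, IsWeightedHomogeneous.aeval_mul hd, hC, h0]
    simp
  have key := taylor_mod_sq (pointIdeal p) b y hy G
  have hX : (fun c => b c + y c) = X := funext fun c => add_sub_cancel _ _
  rw [hb, hX, aeval_X_left_apply] at key
  simpa only [hb', mul_zero, Finset.sum_const_zero, add_zero, sub_zero] using key

theorem mem_doublePointsIdeal_iff {S : Finset (Points K dims)} {G : CoordRing K dims} :
    G ∈ doublePointsIdeal S ↔ ∀ p ∈ S, G ∈ pointIdeal p ^ 2 := by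
  simp [doublePointsIdeal]

theorem mem_doublePointsIdeal_iff_jet {S : Finset (Points K dims)} {G : CoordRing K dims}
    {d : Fin k → ℕ} (hG : IsWeightedHomogeneous multidegree G (fun i => d i + 1)) :
    G ∈ doublePointsIdeal S ↔ ∀ p ∈ S, jet (rep p) G = 0 :=
  mem_doublePointsIdeal_iff.trans
    ⟨fun h p hp => jet_eq_zero_of_mem (h p hp), fun h p hp => mem_pointIdeal_sq hG (h p hp)⟩

end PointIdeal

/-! ### Local sections of the ideal sheaf of the double points, detected by jets. -/

section Sections

variable {K : Type u} [Field K] {k : ℕ} {dims : Fin k → ℕ}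

/-- The first order jet at `v` of rational functions that are regular at `v`, extended linearly to
all rational functions. -/
def germJet (v : Coord dims → K) : Frac K dims →ₗ[K] Jet K dims :=
  (exists_jet_extension v).choose

theorem germJet_mul {v : Coord dims → K} {f : Frac K dims} {g m : CoordRing K dims}
    (hm : eval v m ≠ 0) (h : f * algebraMap _ _ m = algebraMap _ _ g) :
    germJet v f * jet v m = jet v g :=
  (exists_jet_extension v).choose_spec f g m hm h

theorem germJet_algebraMap (v : Coord dims → K) (g : CoordRing K dims) :
    germJet v (algebraMap _ _ g) = jet v g := by
  simpa using germJet_mul (v := v) (f := algebraMap _ _ g) (g := g) (m := 1) (by simp) (by simp)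

theorem chartSections_mono {I J : Ideal (CoordRing K dims)} (h : I ≤ J) (d : Fin k → ℕ) {q : ℕ}
    (t : Fin q → Chart dims) : chartSections I d t ≤ chartSections J d t := by
  rintro f ⟨N, g, hg, H⟩
  exact ⟨N, g, h hg, H⟩

theorem algebraMap_mem_chartSections {I : Ideal (CoordRing K dims)} {d : Fin k → ℕ}
    {g : CoordRing K dims} (hg : g ∈ I) (hd : IsWeightedHomogeneous multidegree g d) {q : ℕ}
    (t : Fin q → Chart dims) : algebraMap _ (Frac K dims) g ∈ chartSections I d t :=
  ⟨0, g, hg, by simpa using hd, by simp⟩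

theorem germJet_eq_zero {S : Finset (Points K dims)} {d : Fin k → ℕ} {q : ℕ}
    {t : Fin q → Chart dims} {f : Frac K dims}
    (hf : f ∈ chartSections (doublePointsIdeal S) d t) {p : Points K dims} (hp : p ∈ S)
    (hpt : eval (rep p) (chartMonomial K t) ≠ 0) : germJet (rep p) f = 0 := by
  obtain ⟨N, g, hg, -, he⟩ := hf
  have hN : eval (rep p) (chartMonomial K t ^ N) ≠ 0 := by
    rw [map_pow]; exact pow_ne_zero _ hpt
  have h1 := germJet_mul hN he
  rw [jet_eq_zero_of_mem (mem_doublePointsIdeal_iff.1 hg p hp)] at h1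
  exact (isUnit_jet hN).mul_left_eq_zero.1 h1

theorem mem_chartSections_of_germJet {S : Finset (Points K dims)} {d : Fin k → ℕ} {q : ℕ}
    {t : Fin q → Chart dims} {f : Frac K dims} {I : Ideal (CoordRing K dims)}
    (hf : f ∈ chartSections I (fun i => d i + 1) t)
    (h : ∀ p ∈ S, eval (rep p) (chartMonomial K t) ≠ 0 → germJet (rep p) f = 0) :
    f ∈ chartSections (doublePointsIdeal S) (fun i => d i + 1) t := by
  obtain ⟨N, g, hg, hd, he⟩ := hf
  -- Nothing is assumed at points of `S` outside the chart. There the chart monomial vanishes, so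
  -- its square puts the numerator in the squared point ideal.
  refine ⟨N + 2, g * chartMonomial K t ^ 2, mem_doublePointsIdeal_iff.2 fun p hp => ?_, ?_, ?_⟩
  · by_cases hpt : eval (rep p) (chartMonomial K t) = 0
    · exact Ideal.mul_mem_left _ _ (Ideal.pow_mem_pow (chartMonomial_mem_pointIdeal hpt) 2)
    · refine Ideal.mul_mem_right _ _ (mem_pointIdeal_sq (d := fun i => d i + N * q) ?_ ?_)
      · convert hd using 2
        ring
      · have hN : eval (rep p) (chartMonomial K t ^ N) ≠ 0 := by
          rw [map_pow]; exact pow_ne_zero _ hpt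
        rw [← germJet_mul hN he, h p hp hpt, zero_mul]
  · convert hd.mul (chartMonomial_pow_isWeightedHomogeneous K t 2) using 1
    funext i
    simp only [Pi.add_apply]
    ring
  · rw [pow_add, map_mul, map_mul, ← he]
    ring

end Sections

/-! ### Global sections and vanishing of `H¹` for `𝒪(d)`. -/

section StructureSheaf

variable {K : Type u} [Field K] {k : ℕ} {dims : Fin k → ℕ}

/-- The exponent all of whose entries are `N`. -/
def constExp (dims : Fin k → ℕ) (N : ℕ) : Coord dims →₀ ℕ := Finsupp.equivFunOnFinite.symm fun _ => N

@[simp]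
theorem constExp_apply (N : ℕ) (c : Coord dims) : constExp dims N c = N := rfl

/-- The exponent of the chart monomial. -/
def chartExp {q : ℕ} (t : Fin q → Chart dims) : Coord dims →₀ ℕ :=
  ∑ l, ∑ i, Finsupp.single ⟨i, t l i⟩ 1

theorem chartMonomial_eq {q : ℕ} (t : Fin q → Chart dims) :
    chartMonomial K t = monomial (chartExp t) 1 := by
  simp only [chartMonomial, chartExp, monomial_sum_one, X]

theorem chartExp_apply {q : ℕ} (t : Fin q → Chart dims) (i : Fin k) (j : Fin (dims i + 1)) :
    chartExp t ⟨i, j⟩ = ∑ l, if t l i = j then 1 else 0 := by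
  rw [chartExp, Finsupp.finsetSum_apply]
  refine Finset.sum_congr rfl fun l _ => ?_
  rw [Finsupp.finsetSum_apply, Finset.sum_eq_single i]
  · by_cases h : t l i = j
    · simp [h]
    · rw [Finsupp.single_apply, if_neg (by simpa using h), if_neg h]
  · intro b _ hb
    rw [Finsupp.single_apply, if_neg]
    intro h
    exact hb (congrArg Sigma.fst h)
  · simp

theorem chartExp_le {q : ℕ} (t : Fin q → Chart dims) (c : Coord dims) : chartExp t c ≤ q := by
  obtain ⟨i, j⟩ := c
  rw [chartExp_apply]
  refine (Finset.sum_le_card_nsmul _ _ 1 fun l _ => ?_).trans (by simp)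
  split_ifs <;> simp

theorem chartExp_pos {q : ℕ} (t : Fin q → Chart dims) (l : Fin q) (i : Fin k) :
    1 ≤ chartExp t ⟨i, t l i⟩ := by
  rw [chartExp_apply]
  refine le_trans (by simp) (Finset.single_le_sum (f := fun l' => if t l' i = t l i then 1 else 0)
    (fun _ _ => Nat.zero_le _) (Finset.mem_univ l))

theorem chartExp_eq_zero {q : ℕ} (t : Fin q → Chart dims) {i : Fin k} {j : Fin (dims i + 1)}
    (h : ∀ l, t l i ≠ j) : chartExp t ⟨i, j⟩ = 0 := by
  rw [chartExp_apply]
  exact Finset.sum_eq_zero fun l _ => if_neg (h l)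

theorem sum_chartExp {q : ℕ} (t : Fin q → Chart dims) (i : Fin k) :
    ∑ j, chartExp t ⟨i, j⟩ = q := by
  simp_rw [chartExp_apply]
  rw [Finset.sum_comm]
  simp

/-- `G` is the numerator, over the `N`-th power of the product of all coordinates, of a section of
`𝒪(d)` over the intersection of the charts `t`. -/
def IsNumerator (d : Fin k → ℕ) {q : ℕ} (t : Fin q → Chart dims) (N : ℕ)
    (G : CoordRing K dims) : Prop :=
  ∀ e ∈ G.support, (∀ i, ∑ j, e ⟨i, j⟩ = d i + N * (dims i + 1)) ∧
    ∀ i j, (∀ l, t l i ≠ j) → N ≤ e ⟨i, j⟩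

variable (K) in
/-- The `N`-th power of the product of all coordinates, as a rational function. -/
def denom (dims : Fin k → ℕ) (N : ℕ) : Frac K dims :=
  algebraMap (CoordRing K dims) _ (monomial (constExp dims N) 1)

theorem denom_ne_zero (N : ℕ) : denom K dims N ≠ 0 := by
  rw [denom, Ne, FaithfulSMul.algebraMap_eq_zero_iff, monomial_eq_zero]
  exact one_ne_zero

/-- Each coordinate occurs at most `q` times in the chart monomial, so its `N`-th power divides any
`M`-th power of the product of all coordinates with `M ≥ N * q`. Having all large exponents
available lets finitely many sections share one denominator, after which they can be compared
monomial by monomial. -/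
theorem exists_isNumerator {d : Fin k → ℕ} {q : ℕ} {t : Fin q → Chart dims} {f : Frac K dims}
    {I : Ideal (CoordRing K dims)} (hf : f ∈ chartSections I d t) :
    ∃ N₀, ∀ N, N₀ ≤ N → ∃ G : CoordRing K dims, IsNumerator d t N G ∧
      f * denom K dims N = algebraMap _ _ G := by
  obtain ⟨N, g, -, hd, he⟩ := hf
  refine ⟨N * q, fun M hM => ?_⟩
  let s : Coord dims →₀ ℕ := constExp dims M - N • chartExp t
  have hle : ∀ c, N * chartExp t c ≤ M := fun c =>
    (Nat.mul_le_mul_left N (chartExp_le t c)).trans hM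
  have hs : ∀ c, s c + N * chartExp t c = M := fun c => Nat.sub_add_cancel (hle c)
  refine ⟨g * monomial s 1, fun e he => ?_, ?_⟩
  · obtain ⟨e', he', rfl⟩ : ∃ e' ∈ g.support, e' + s = e := by
      classical
      have := support_mul g (monomial s (1 : K)) he
      rw [Finset.mem_add] at this
      obtain ⟨a, ha, b, hb, rfl⟩ := this
      rw [Finset.mem_singleton.1 (support_monomial_subset hb)]
      exact ⟨a, ha, rfl⟩
    constructor
    · intro i
      have h1 := isWeightedHomogeneous_iff.1 hd e' he' i
      have h2 : ∑ j, (s ⟨i, j⟩ + N * chartExp t ⟨i, j⟩) = M * (dims i + 1) := by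
        simp_rw [hs]
        simp [mul_comm]
      rw [Finset.sum_add_distrib, ← Finset.mul_sum, sum_chartExp] at h2
      simp only [Finsupp.add_apply, Finset.sum_add_distrib, h1]
      omega
    · intro i j hij
      have := hs ⟨i, j⟩
      rw [chartExp_eq_zero t hij] at this
      simp only [Finsupp.add_apply]
      omega
  · have : (monomial (constExp dims M) 1 : CoordRing K dims) =
        chartMonomial K t ^ N * monomial s 1 := by
      rw [chartMonomial_eq, monomial_pow, monomial_mul, one_pow, one_mul]
      congr 2
      ext c
      have := hs c
      simp only [Finsupp.add_apply, Finsupp.smul_apply, smul_eq_mul, constExp_apply]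
      omega
    rw [denom, this, map_mul, ← mul_assoc, he, ← map_mul]

theorem exists_eq_monomial_mul {G : CoordRing K dims} {d : Fin k → ℕ}
    (s : Coord dims →₀ ℕ) (hs : ∀ e ∈ G.support, s ≤ e)
    (hd : ∀ e ∈ G.support, ∀ i, ∑ j, e ⟨i, j⟩ = d i + ∑ j, s ⟨i, j⟩) :
    ∃ g : CoordRing K dims, IsWeightedHomogeneous multidegree g d ∧ G = monomial s 1 * g := by
  obtain ⟨g, rfl⟩ : monomial s 1 ∣ G := by
    rw [monomial_one_dvd_iff_modMonomial_eq_zero]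
    ext e
    by_cases h : s ≤ e
    · rw [coeff_modMonomial_of_le _ h, coeff_zero]
    · rw [coeff_modMonomial_of_not_le _ h, coeff_zero]
      by_contra hc
      exact h (hs e (mem_support_iff.2 hc))
  refine ⟨g, isWeightedHomogeneous_iff.2 fun e he i => ?_, rfl⟩
  have := hd (s + e) (by rw [mem_support_iff, coeff_monomial_mul, one_mul]; exact mem_support_iff.1 he) i
  simp only [Finsupp.add_apply, Finset.sum_add_distrib] at this
  omega

theorem mem_chartSections_of_isNumerator {d : Fin k → ℕ} {q : ℕ} {t : Fin q → Chart dims}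
    {f : Frac K dims} {N : ℕ} {G : CoordRing K dims} (hG : IsNumerator d t N G)
    (hf : f * denom K dims N = algebraMap _ _ G) : f ∈ chartSections ⊤ d t := by
  have hsupp : ∀ e ∈ (G * chartMonomial K t ^ N).support,
      ∃ e' ∈ G.support, e' + N • chartExp t = e := by
    classical
    intro e he
    rw [chartMonomial_eq, monomial_pow] at he
    have := support_mul _ _ he
    rw [Finset.mem_add] at this
    obtain ⟨a, ha, b, hb, rfl⟩ := this
    rw [Finset.mem_singleton.1 (support_monomial_subset hb)]
    exact ⟨a, ha, rfl⟩
  obtain ⟨g, hg, he⟩ := exists_eq_monomial_mul (G := G * chartMonomial K t ^ N)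
    (d := fun i => d i + N * q) (constExp dims N) (by
      intro e he
      obtain ⟨e', he', rfl⟩ := hsupp e he
      rintro ⟨i, j⟩
      simp only [constExp_apply, Finsupp.add_apply, Finsupp.smul_apply, smul_eq_mul]
      by_cases h : ∀ l, t l i ≠ j
      · exact ((hG e' he').2 i j h).trans (Nat.le_add_right _ _)
      · push Not at h
        obtain ⟨l, rfl⟩ := h
        exact le_add_left (Nat.le_mul_of_pos_right N (chartExp_pos t l i))) (by
      intro e he i
      obtain ⟨e', he', rfl⟩ := hsupp e he
      have := (hG e' he').1 i
      simp only [Finsupp.add_apply, Finsupp.smul_apply, smul_eq_mul, Finset.sum_add_distrib,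
        ← Finset.mul_sum, sum_chartExp, this]
      simp
      ring)
  refine ⟨N, g, trivial, hg, mul_right_cancel₀ (denom_ne_zero (K := K) (dims := dims) N) ?_⟩
  rw [mul_right_comm, hf, ← map_mul, he, denom, ← map_mul, mul_comm g]

/-- Pigeonhole in each block, using that `d` is nonnegative: the Laurent monomial with numerator
exponent `e` has no pole along at least one coordinate of each block. -/
theorem exists_chart_ge {d : Fin k → ℕ} (N : ℕ) {e : Coord dims →₀ ℕ}
    (h : ∀ i, ∑ j, e ⟨i, j⟩ = d i + N * (dims i + 1)) :
    ∃ s : Chart dims, ∀ i, N ≤ e ⟨i, s i⟩ := by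
  have : ∀ i, ∃ j, N ≤ e ⟨i, j⟩ := by
    intro i
    obtain ⟨j, -, hj⟩ := Finset.exists_le_of_sum_le (s := Finset.univ) (f := fun _ => N)
      (g := fun j => e ⟨i, j⟩) Finset.univ_nonempty (by rw [h i]; simp [mul_comm])
    exact ⟨j, hj⟩
  choose s hs using this
  exact ⟨s, hs⟩

/-- `H⁰(𝒪(d))` consists of the forms of multidegree `d`. -/
theorem exists_form_of_forall_mem {d : Fin k → ℕ} {f : Frac K dims}
    (h : ∀ t : Fin 1 → Chart dims, f ∈ chartSections ⊤ d t) :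
    ∃ g : CoordRing K dims, IsWeightedHomogeneous multidegree g d ∧ algebraMap _ _ g = f := by
  choose N₀ hN₀ using fun t => exists_isNumerator (h t)
  let N := Finset.univ.sup N₀
  have hN : ∀ t, N₀ t ≤ N := fun t => Finset.le_sup (Finset.mem_univ t)
  choose G hG hfG using fun t => hN₀ t N (hN t)
  have hGe : ∀ t s, G t = G s := fun t s =>
    FaithfulSMul.algebraMap_injective _ (Frac K dims) ((hfG t).symm.trans (hfG s))
  let t₀ : Fin 1 → Chart dims := fun _ _ => 0
  obtain ⟨g, hg, he⟩ := exists_eq_monomial_mul (G := G t₀) (d := d) (constExp dims N) (by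
      intro e he
      -- Since all charts give the same numerator, `e` may be read on the chart `s`: off `s` its
      -- entries are at least `N` by regularity there, on `s` by the choice of `s`.
      obtain ⟨s, hs⟩ := exists_chart_ge N (hG t₀ e he).1
      rintro ⟨i, j⟩
      by_cases hj : s i = j
      · rw [← hj]; exact hs i
      · rw [hGe t₀ fun _ => s] at he
        exact (hG _ e he).2 i j fun _ => hj) (by
      intro e he i
      rw [(hG t₀ e he).1 i]
      simp [mul_comm])
  refine ⟨g, hg, mul_right_cancel₀ (denom_ne_zero (K := K) (dims := dims) N) ?_⟩
  rw [hfG t₀, he, map_mul, mul_comm, denom]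

theorem cechDiff_zero_apply (b : (Fin 1 → Chart dims) → Frac K dims) (t : Fin 2 → Chart dims) :
    cechDiff K dims 0 b t = b (fun _ => t 1) - b (fun _ => t 0) := by
  have h0 : (fun s : Fin 1 => t ((0 : Fin 2).succAbove s)) = fun _ => t 1 := by
    funext s; fin_cases s; rfl
  have h1 : (fun s : Fin 1 => t ((1 : Fin 2).succAbove s)) = fun _ => t 0 := by
    funext s; fin_cases s; rfl
  simp only [cechDiff, LinearMap.pi_apply, LinearMap.sum_apply, LinearMap.smul_apply,
    LinearMap.proj_apply]
  rw [Fin.sum_univ_two, h0, h1]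
  simp [sub_eq_add_neg]

theorem cechDiff_one_apply (c : (Fin 2 → Chart dims) → Frac K dims) (s t u : Chart dims) :
    cechDiff K dims 1 c ![s, t, u] = c ![t, u] - c ![s, u] + c ![s, t] := by
  have h0 : (fun l : Fin 2 => ![s, t, u] ((0 : Fin 3).succAbove l)) = ![t, u] := by
    funext l; fin_cases l <;> rfl
  have h1 : (fun l : Fin 2 => ![s, t, u] ((1 : Fin 3).succAbove l)) = ![s, u] := by
    funext l; fin_cases l <;> rfl
  have h2 : (fun l : Fin 2 => ![s, t, u] ((2 : Fin 3).succAbove l)) = ![s, t] := by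
    funext l; fin_cases l <;> rfl
  simp only [cechDiff, LinearMap.pi_apply, LinearMap.sum_apply, LinearMap.smul_apply,
    LinearMap.proj_apply]
  rw [Fin.sum_univ_three, h0, h1, h2]
  simp [sub_eq_add_neg]

theorem cechDiff_one_zero (b : (Fin 1 → Chart dims) → Frac K dims) :
    cechDiff K dims 1 (cechDiff K dims 0 b) = 0 := by
  funext t
  have : t = ![t 0, t 1, t 2] := by funext l; fin_cases l <;> rfl
  rw [this, cechDiff_one_apply]
  simp only [cechDiff_zero_apply]
  simp

/-- `H¹(𝒪(d)) = 0`. -/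
theorem exists_cochain_of_cocycle {d : Fin k → ℕ} {c : (Fin 2 → Chart dims) → Frac K dims}
    (hc : c ∈ cocycles (⊤ : Ideal (CoordRing K dims)) d 1) :
    ∃ b ∈ cochains (⊤ : Ideal (CoordRing K dims)) d 0, cechDiff K dims 0 b = c := by
  classical
  obtain ⟨hc, hz⟩ := hc
  have hc : ∀ t, c t ∈ chartSections ⊤ d t := fun t => hc t trivial
  choose N₀ hN₀ using fun t => exists_isNumerator (hc t)
  let N := Finset.univ.sup N₀
  have hN : ∀ t, N₀ t ≤ N := fun t => Finset.le_sup (Finset.mem_univ t)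
  choose G hG hfG using fun t => hN₀ t N (hN t)
  have hD := denom_ne_zero (K := K) (dims := dims) N
  have hcoc : ∀ s t u, G ![t, u] = G ![s, u] - G ![s, t] := by
    intro s t u
    apply FaithfulSMul.algebraMap_injective _ (Frac K dims)
    have h := congrFun (LinearMap.mem_ker.1 hz) ![s, t, u]
    rw [cechDiff_one_apply, Pi.zero_apply] at h
    rw [map_sub, ← hfG, ← hfG, ← hfG, ← sub_mul]
    congr 1
    linear_combination h
  -- The chart `σ e` depends on the monomial only, and its coordinates carry no pole of that
  -- monomial. The default value is irrelevant, since exponents without such a chart occur in no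
  -- numerator.
  let σ : (Coord dims →₀ ℕ) → Chart dims := fun e =>
    if h : ∃ s : Chart dims, ∀ i, N ≤ e ⟨i, s i⟩ then h.choose else fun _ => 0
  have hσ : ∀ t, ∀ e ∈ (G t).support, ∀ i, N ≤ e ⟨i, σ e i⟩ := by
    intro t e he
    have h := exists_chart_ge N (hG t e he).1
    simp only [σ, dif_pos h]
    exact h.choose_spec
  let F : Finset (Coord dims →₀ ℕ) := Finset.univ.biUnion fun t => (G t).support
  have hF : ∀ t e, e ∉ F → coeff e (G t) = 0 := fun t e he => by
    by_contra h
    exact he (Finset.mem_biUnion.2 ⟨t, Finset.mem_univ t, mem_support_iff.2 h⟩)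
  -- Contracting homotopy, one monomial at a time: the coefficient of `e` over `t` is that of the
  -- cocycle at `(σ e, t)`. The choice of `σ e` makes this regular over `t` alone, and the cocycle
  -- identity for `(σ e, t 0, t 1)` gives the coboundary.
  let B : Chart dims → CoordRing K dims := fun t => ∑ e ∈ F, monomial e (coeff e (G ![σ e, t]))
  have hB : ∀ t e, coeff e (B t) = coeff e (G ![σ e, t]) := by
    intro t e
    simp only [B, coeff_sum, coeff_monomial, Finset.sum_ite_eq']
    split_ifs with h
    · rfl
    · exact (hF _ _ h).symm
  refine ⟨fun t => algebraMap _ _ (B (t 0)) / denom K dims N, fun t _ => ?_, ?_⟩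
  · refine mem_chartSections_of_isNumerator (N := N) (G := B (t 0)) (fun e he => ?_)
      (div_mul_cancel₀ _ hD)
    rw [mem_support_iff, hB, ← mem_support_iff] at he
    refine ⟨(hG _ e he).1, fun i j hij => ?_⟩
    by_cases hj : σ e i = j
    · rw [← hj]; exact hσ _ e he i
    · refine (hG _ e he).2 i j fun l => ?_
      fin_cases l
      · exact hj
      · exact hij 0
  · funext t
    have ht : t = ![t 0, t 1] := by funext l; fin_cases l <;> rfl
    rw [cechDiff_zero_apply, ← sub_div, div_eq_iff hD, hfG, ← map_sub]
    congr 1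
    ext e
    rw [coeff_sub, hB, hB, ← coeff_sub, ← hcoc, ← ht]

end StructureSheaf

/-! ### Products of linear forms and the jets they realize. -/

section Forms

variable {K : Type u} [Field K]

theorem exists_dot_eq_one {m : ℕ} {U : Submodule K (Fin m → K)} {x : Fin m → K} (hx : x ∉ U) :
    ∃ f : Fin m → K, (∀ y ∈ U, ∑ j, f j * y j = 0) ∧ ∑ j, f j * x j = 1 := by
  obtain ⟨φ, hφ, hU⟩ := Submodule.exists_le_ker_of_notMem hx
  have h : ∀ y, ∑ j, φ (Pi.single j 1) * y j = φ y := fun y => by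
    conv_rhs => rw [← Finset.univ_sum_single y, map_sum]
    refine Finset.sum_congr rfl fun j _ => ?_
    rw [mul_comm, ← smul_eq_mul, ← map_smul, ← Pi.single_smul, smul_eq_mul, mul_one]
  refine ⟨fun j => (φ x)⁻¹ * φ (Pi.single j 1), fun y hy => ?_, ?_⟩
  · simp_rw [mul_assoc, ← Finset.mul_sum, h, LinearMap.mem_ker.1 (hU hy), mul_zero]
  · simp_rw [mul_assoc, ← Finset.mul_sum, h]
    exact inv_mul_cancel₀ hφ

variable {k : ℕ} {dims : Fin k → ℕ}

/-- The value of a linear form on the `i`-th block of a vector. -/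
def blockVal (v : Coord dims → K) (i : Fin k) (f : Fin (dims i + 1) → K) : K :=
  ∑ j, f j * v ⟨i, j⟩

/-- A linear form in the `i`-th block of variables. -/
def linForm (i : Fin k) (f : Fin (dims i + 1) → K) : CoordRing K dims :=
  ∑ j, C (f j) * X ⟨i, j⟩

/-- The product of one linear form in each block of variables. -/
def prodForm (f : ∀ i : Fin k, Fin (dims i + 1) → K) : CoordRing K dims :=
  ∏ i, linForm i (f i)

theorem eval_linForm (v : Coord dims → K) (i : Fin k) (f : Fin (dims i + 1) → K) :
    eval v (linForm i f) = blockVal v i f := by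
  simp [linForm, blockVal]

theorem prodForm_isWeightedHomogeneous (f : ∀ i : Fin k, Fin (dims i + 1) → K) :
    IsWeightedHomogeneous multidegree (prodForm f) (fun _ => 1) := by
  have h : IsWeightedHomogeneous multidegree (prodForm f) (∑ i : Fin k, Pi.single i 1) := by
    refine IsWeightedHomogeneous.prod _ _ _ fun i _ => ?_
    refine IsWeightedHomogeneous.sum _ _ _ fun j _ => ?_
    exact (isWeightedHomogeneous_X K multidegree (⟨i, j⟩ : Coord dims)).C_mul _
  convert h using 1
  funext i
  simp [Finset.sum_apply, Pi.single_apply]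

theorem eval_prodForm (v : Coord dims → K) (f : ∀ i : Fin k, Fin (dims i + 1) → K) :
    eval v (prodForm f) = ∏ i, blockVal v i (f i) := by
  simp [prodForm, eval_linForm]

theorem pderiv_linForm_self (i : Fin k) (j : Fin (dims i + 1)) (f : Fin (dims i + 1) → K) :
    pderiv (⟨i, j⟩ : Coord dims) (linForm i f) = C (f j) := by
  rw [linForm, map_sum, Finset.sum_eq_single j]
  · simp
  · intro b _ hb
    simp [pderiv_X, hb]
  · simp

theorem pderiv_linForm_ne {i i' : Fin k} (h : i' ≠ i) (j : Fin (dims i + 1))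
    (f : Fin (dims i' + 1) → K) : pderiv (⟨i, j⟩ : Coord dims) (linForm i' f) = 0 := by
  rw [linForm, map_sum]
  refine Finset.sum_eq_zero fun b _ => ?_
  have : (⟨i', b⟩ : Coord dims) ≠ ⟨i, j⟩ := fun e => h (congrArg Sigma.fst e)
  simp [pderiv_X, this]

theorem snd_jet_prodForm (v : Coord dims → K) (f : ∀ i : Fin k, Fin (dims i + 1) → K)
    (i : Fin k) (j : Fin (dims i + 1)) :
    (jet v (prodForm f)).snd ⟨i, j⟩ =
      f i j * ∏ i' ∈ Finset.univ.erase i, blockVal v i' (f i') := by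
  have h0 : ∀ s : Finset (Fin k), i ∉ s →
      pderiv (⟨i, j⟩ : Coord dims) (∏ i' ∈ s, linForm i' (f i')) = 0 := by
    intro s
    induction s using Finset.induction_on with
    | empty => simp
    | insert a s ha ih =>
      intro hi
      rw [Finset.prod_insert ha, Derivation.leibniz, ih fun h => hi (Finset.mem_insert_of_mem h),
        pderiv_linForm_ne]
      · simp
      · rintro rfl
        exact hi (Finset.mem_insert_self _ _)
  rw [snd_jet, prodForm, ← Finset.mul_prod_erase _ _ (Finset.mem_univ i), Derivation.leibniz,
    h0 _ (Finset.notMem_erase _ _), pderiv_linForm_self]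
  simp [eval_linForm, mul_comm]

theorem fst_jet_prodForm (v : Coord dims → K) (f : ∀ i : Fin k, Fin (dims i + 1) → K) :
    (jet v (prodForm f)).fst = ∏ i, blockVal v i (f i) := by
  rw [fst_jet, eval_prodForm]

theorem jet_prodForm_eq_zero {v : Coord dims → K} {f : ∀ i : Fin k, Fin (dims i + 1) → K}
    {i i' : Fin k} (hne : i ≠ i') (hi : blockVal v i (f i) = 0) (hi' : blockVal v i' (f i') = 0) :
    jet v (prodForm f) = 0 := by
  ext c
  · rw [fst_jet_prodForm, Finset.prod_eq_zero (Finset.mem_univ i) hi]; rfl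
  · obtain ⟨l, j⟩ := c
    rw [snd_jet_prodForm]
    by_cases h : i = l
    · subst h
      rw [Finset.prod_eq_zero (Finset.mem_erase.2 ⟨hne.symm, Finset.mem_univ _⟩) hi', mul_zero]; rfl
    · rw [Finset.prod_eq_zero (Finset.mem_erase.2 ⟨h, Finset.mem_univ _⟩) hi, mul_zero]; rfl

/-- Euler's identities in degree `a`, for the jet `α` at `v`. -/
def HasEulerWeight (v : Coord dims → K) (α : Jet K dims) (a : K) : Prop :=
  ∀ i, ∑ j, v ⟨i, j⟩ * α.snd ⟨i, j⟩ = a * α.fst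

theorem hasEulerWeight_jet (v : Coord dims → K) {G : CoordRing K dims} {d : ℕ}
    (hG : IsWeightedHomogeneous multidegree G (fun _ => d)) : HasEulerWeight v (jet v G) d := by
  intro i
  have h := congrArg (eval v) (euler_block hG i)
  simpa [snd_jet, fst_jet] using h

theorem sum_snd_mul (v : Coord dims → K) (α β : Jet K dims) (i : Fin k) :
    ∑ j, v ⟨i, j⟩ * (α * β).snd ⟨i, j⟩ =
      α.fst * ∑ j, v ⟨i, j⟩ * β.snd ⟨i, j⟩ + β.fst * ∑ j, v ⟨i, j⟩ * α.snd ⟨i, j⟩ := by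
  rw [Finset.mul_sum, Finset.mul_sum, ← Finset.sum_add_distrib]
  refine Finset.sum_congr rfl fun j _ => ?_
  simp
  ring

theorem HasEulerWeight.mul {v : Coord dims → K} {α β : Jet K dims} {a b : K}
    (hα : HasEulerWeight v α a) (hβ : HasEulerWeight v β b) :
    HasEulerWeight v (α * β) (a + b) := by
  intro i
  rw [sum_snd_mul, hα i, hβ i, TrivSqZeroExt.fst_mul]
  ring

theorem HasEulerWeight.of_mul {v : Coord dims → K} {α β : Jet K dims} {a b c : K}
    (h : HasEulerWeight v (α * β) c) (hβ : HasEulerWeight v β b) (h0 : β.fst ≠ 0)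
    (hc : c = a + b) : HasEulerWeight v α a := by
  subst hc
  intro i
  have := h i
  rw [sum_snd_mul, hβ i, TrivSqZeroExt.fst_mul] at this
  refine mul_left_cancel₀ h0 ?_
  linear_combination this

variable (K dims) in
/-- The forms of multidegree `(1, …, 1)`. -/
abbrev multilinearForms : Submodule K (CoordRing K dims) :=
  weightedHomogeneousSubmodule K multidegree (fun _ => 1)

/-- The defining map of `eulerSpace`. -/
def eulerMap (v : Coord dims → K) : Jet K dims →ₗ[K] (Fin k → K) where
  toFun α := fun i => ∑ j, v ⟨i, j⟩ * α.snd ⟨i, j⟩ - α.fst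
  map_add' α β := by
    funext i
    simp [mul_add, Finset.sum_add_distrib]
    ring
  map_smul' a α := by
    funext i
    simp [mul_sub, Finset.mul_sum, mul_left_comm]

/-- The jets at `v` of sections of `𝒪(1, …, 1)`. -/
def eulerSpace (v : Coord dims → K) : Submodule K (Jet K dims) := LinearMap.ker (eulerMap v)

theorem mem_eulerSpace {v : Coord dims → K} {α : Jet K dims} :
    α ∈ eulerSpace v ↔ HasEulerWeight v α 1 := by
  rw [eulerSpace, LinearMap.mem_ker, funext_iff]
  exact forall_congr' fun i => by rw [one_mul]; exact sub_eq_zero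

instance : Module.Finite K (Jet K dims) := inferInstanceAs (Module.Finite K (K × (Coord dims → K)))

theorem finrank_jet : Module.finrank K (Jet K dims) = ∑ i, dims i + k + 1 := by
  have : Module.finrank K (Jet K dims) = Module.finrank K (K × (Coord dims → K)) := rfl
  rw [this, Module.finrank_prod, Module.finrank_self, Module.finrank_fintype_fun_eq_card,
    Fintype.card_sigma]
  simp [Finset.sum_add_distrib]
  ring

/-- Jets form a space of dimension `n + k + 1`, cut by one Euler relation per block. The `k`
relations are independent because every block of `v` has a nonzero coordinate. -/
theorem finrank_eulerSpace {v : Coord dims → K} (hv : ∀ i, ∃ j, v ⟨i, j⟩ ≠ 0) :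
    Module.finrank K (eulerSpace v) = ∑ i, dims i + 1 := by
  have hs : Function.Surjective (eulerMap v) := by
    choose a ha using hv
    intro y
    refine ⟨TrivSqZeroExt.inr fun c => if a c.1 = c.2 then (v c)⁻¹ * y c.1 else 0, ?_⟩
    funext i
    simp only [eulerMap, LinearMap.coe_mk, AddHom.coe_mk, TrivSqZeroExt.snd_inr,
      TrivSqZeroExt.fst_inr, sub_zero, mul_ite, mul_zero, Finset.sum_ite_eq, Finset.mem_univ,
      if_true]
    rw [mul_inv_cancel_left₀ (ha i)]
  have h := LinearMap.finrank_range_add_finrank_ker (eulerMap v)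
  rw [LinearMap.range_eq_top.2 hs, finrank_top, Module.finrank_fin_fun, finrank_jet] at h
  rw [eulerSpace]
  omega

theorem exists_block_eq_one {v : Coord dims → K} {i : Fin k} (hv : ∃ j, v ⟨i, j⟩ ≠ 0) :
    ∃ f, blockVal v i f = 1 := by
  obtain ⟨j, hj⟩ := hv
  obtain ⟨f, -, hf⟩ := exists_dot_eq_one (U := ⊥) (x := fun j => v ⟨i, j⟩)
    (fun h => hj (congrFun ((Submodule.mem_bot K).1 h) j))
  exact ⟨f, hf⟩

/-- A product of linear forms with value one in each block realizes the value of `α`. Replacing its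
`i`-th factor by a form vanishing at `v` changes only the `i`-th block of the gradient; the
correction `g i` needed there does vanish at `v`, by the Euler relation. -/
theorem exists_form_jet {v : Coord dims → K} (hv : ∀ i, ∃ j, v ⟨i, j⟩ ≠ 0) {α : Jet K dims}
    (hα : α ∈ eulerSpace v) : ∃ L ∈ multilinearForms K dims, jet v L = α := by
  rw [mem_eulerSpace] at hα
  choose f hf using fun i => exists_block_eq_one (hv i)
  let g : ∀ i : Fin k, Fin (dims i + 1) → K := fun i j => α.snd ⟨i, j⟩ - α.fst * f i j
  have hg : ∀ i, blockVal v i (g i) = 0 := by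
    intro i
    have h1 := hα i
    have h2 := hf i
    simp only [blockVal] at h2
    simp only [blockVal, g, sub_mul, Finset.sum_sub_distrib, mul_assoc, ← Finset.mul_sum, h2]
    simp_rw [mul_comm (TrivSqZeroExt.snd α _)]
    rw [h1]
    ring
  have hu : ∀ l i, l ≠ i → blockVal v l (Function.update f i (g i) l) = 1 := by
    intro l i h
    rw [Function.update_of_ne h, hf]
  refine ⟨α.fst • prodForm f + ∑ i, prodForm (Function.update f i (g i)), ?_, ?_⟩
  · exact add_mem (Submodule.smul_mem _ _ (prodForm_isWeightedHomogeneous f))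
      (sum_mem fun i _ => prodForm_isWeightedHomogeneous _)
  · rw [map_add, map_smul, map_sum]
    ext c
    · rw [TrivSqZeroExt.fst_add, TrivSqZeroExt.fst_smul, fst_jet_prodForm, TrivSqZeroExt.fst_sum]
      rw [Finset.sum_eq_zero fun i _ => ?_]
      · simp [hf]
      · rw [fst_jet_prodForm]
        exact Finset.prod_eq_zero (Finset.mem_univ i) (by rw [Function.update_self, hg])
    · obtain ⟨i, j⟩ := c
      rw [TrivSqZeroExt.snd_add, TrivSqZeroExt.snd_smul, TrivSqZeroExt.snd_sum, Pi.add_apply,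
        Pi.smul_apply, snd_jet_prodForm, Finset.sum_apply, Finset.sum_eq_single i]
      · rw [snd_jet_prodForm, Function.update_self,
          Finset.prod_congr rfl fun l hl => hu l i (Finset.ne_of_mem_erase hl)]
        simp [hf, g]
      · intro l _ hl
        rw [snd_jet_prodForm, Finset.prod_eq_zero (i := l), mul_zero]
        · exact Finset.mem_erase.2 ⟨hl, Finset.mem_univ _⟩
        · rw [Function.update_self, hg]
      · simp

theorem rep_block_ne_smul {p q : Points K dims} {i : Fin k} (h : p i ≠ q i) :
    (p i).rep ∉ Submodule.span K {(q i).rep} := by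
  rw [← Projectivization.submodule_eq]
  intro hm
  refine h (Projectivization.submodule_injective ?_)
  apply Submodule.eq_of_le_of_finrank_eq
  · rw [Projectivization.submodule_eq (p i), Submodule.span_singleton_le_iff_mem]
    exact hm
  · rw [Projectivization.finrank_submodule, Projectivization.finrank_submodule]

theorem exists_block_separating {p q : Points K dims} {i : Fin k} (h : p i ≠ q i) :
    ∃ f, blockVal (rep q) i f = 0 ∧ blockVal (rep p) i f = 1 := by
  obtain ⟨f, h0, h1⟩ := exists_dot_eq_one (rep_block_ne_smul h)
  exact ⟨f, h0 _ (Submodule.mem_span_singleton_self _), h1⟩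

/-- For each `q ≠ p` in `S`, multiply by the square of a multilinear form vanishing at `q` but not
at `p`. -/
theorem exists_form_separating (S : Finset (Points K dims)) (p : Points K dims) :
    ∃ (D : ℕ) (G : CoordRing K dims), IsWeightedHomogeneous multidegree G (fun _ => D) ∧
      eval (rep p) G ≠ 0 ∧ ∀ q ∈ S, q ≠ p → jet (rep q) G = 0 := by
  classical
  induction S using Finset.induction_on with
  | empty => exact ⟨0, 1, isWeightedHomogeneous_one _ _, by simp, by simp⟩
  | insert q S hq ih =>
    obtain ⟨D, G, hG, h1, h2⟩ := ih
    by_cases hqp : q = p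
    · refine ⟨D, G, hG, h1, fun x hx hxp => h2 x ?_ hxp⟩
      exact (Finset.mem_insert.1 hx).resolve_left fun h => hxp (h.trans hqp)
    · obtain ⟨i, hi⟩ := Function.ne_iff.1 hqp
      choose f hf using fun l => exists_block_eq_one (exists_rep_ne_zero p l)
      obtain ⟨g, hg0, hg1⟩ := exists_block_separating (Ne.symm hi)
      let F := prodForm (Function.update f i g)
      have hF : eval (rep q) F = 0 := by
        rw [eval_prodForm]
        exact Finset.prod_eq_zero (Finset.mem_univ i) (by rw [Function.update_self, hg0])
      have hFp : eval (rep p) F = 1 := by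
        rw [eval_prodForm]
        refine Finset.prod_eq_one fun l _ => ?_
        by_cases hl : l = i
        · subst hl; rw [Function.update_self, hg1]
        · rw [Function.update_of_ne hl, hf]
      refine ⟨D + 2, G * F ^ 2, ?_, ?_, fun x hx hxp => ?_⟩
      · convert hG.mul ((prodForm_isWeightedHomogeneous (Function.update f i g)).pow 2) using 1
        funext l
        simp
      · simpa [hFp] using h1
      · rw [map_mul]
        rcases Finset.mem_insert.1 hx with rfl | hx
        · rw [jet_sq_eq_zero hF, mul_zero]
        · rw [h2 x hx hxp, zero_mul]

end Forms

/-! ### Comparison of two quotients of a common space. -/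

section LinearAlgebra

variable {K V X Y : Type*} [Field K] [AddCommGroup V] [Module K V] [AddCommGroup X] [Module K X]
  [AddCommGroup Y] [Module K Y]

theorem finrank_quotient_map_eq (B : Submodule K V) (D : V →ₗ[K] X) (C' : Submodule K X) :
    Module.finrank K (B.map D ⧸ C'.submoduleOf (B.map D)) =
      Module.finrank K (B ⧸ (C'.comap D).submoduleOf B) := by
  let θ : B →ₗ[K] (B.map D ⧸ C'.submoduleOf (B.map D)) :=
    (C'.submoduleOf (B.map D)).mkQ ∘ₗ D.submoduleMap B
  have hθ : Function.Surjective θ :=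
    (Submodule.mkQ_surjective _).comp (D.submoduleMap_surjective B)
  have hk : LinearMap.ker θ = (C'.comap D).submoduleOf B := by
    rw [LinearMap.ker_comp, Submodule.ker_mkQ]
    rfl
  rw [← hk]
  exact (LinearEquiv.finrank_eq (θ.quotKerEquivOfSurjective hθ)).symm

/-- Both sides are the quotient of `B` by the same subspace. With `D` the Čech differential and `Φ`
the jets, this replaces the connecting homomorphism of the long exact sequence. -/
theorem finrank_quotient_map_eq_of_iff (B : Submodule K V) (D : V →ₗ[K] X) (Φ : V →ₗ[K] Y)
    (C' : Submodule K X) (T' : Submodule K Y) (h : ∀ b ∈ B, D b ∈ C' ↔ Φ b ∈ T') :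
    Module.finrank K (B.map D ⧸ C'.submoduleOf (B.map D)) =
      Module.finrank K (B.map Φ ⧸ T'.submoduleOf (B.map Φ)) := by
  have : (C'.comap D).submoduleOf B = (T'.comap Φ).submoduleOf B := by
    ext b
    simp only [Submodule.submoduleOf, Submodule.mem_comap]
    exact h b b.2
  rw [finrank_quotient_map_eq, finrank_quotient_map_eq, this]

end LinearAlgebra

/-! ### The defect and `h⁰` through the jet map on multilinear forms. -/

section Cohomology

variable {K : Type u} [Field K] {k : ℕ} {dims : Fin k → ℕ}

theorem chartMonomial_pair (t : Fin 2 → Chart dims) :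
    chartMonomial K t =
      chartMonomial K (fun _ : Fin 1 => t 0) * chartMonomial K fun _ : Fin 1 => t 1 := by
  simp [chartMonomial, Fin.prod_univ_two]

theorem restrict_mem_chartSections {I : Ideal (CoordRing K dims)} {d : Fin k → ℕ}
    {t t' : Fin 1 → Chart dims} {s : Fin 2 → Chart dims} {f : Frac K dims}
    (hs : chartMonomial K s = chartMonomial K t * chartMonomial K t')
    (hf : f ∈ chartSections I d t) : f ∈ chartSections I d s := by
  obtain ⟨N, g, hg, hd, he⟩ := hf
  refine ⟨N, g * chartMonomial K t' ^ N, I.mul_mem_right _ hg, ?_, ?_⟩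
  · convert hd.mul (chartMonomial_pow_isWeightedHomogeneous K t' N) using 1
    funext i
    simp only [Pi.add_apply]
    ring
  · rw [hs, mul_pow, map_mul, ← mul_assoc, he, map_mul]

theorem cechDiff_mem_cochains {I : Ideal (CoordRing K dims)} {d : Fin k → ℕ}
    {b : (Fin 1 → Chart dims) → Frac K dims} (hb : b ∈ cochains I d 0) :
    cechDiff K dims 0 b ∈ cochains I d 1 := by
  intro t _
  rw [cechDiff_zero_apply]
  have h := chartMonomial_pair (K := K) t
  exact sub_mem (restrict_mem_chartSections (h.trans (mul_comm _ _)) (hb _ trivial))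
    (restrict_mem_chartSections h (hb _ trivial))

theorem eval_chartMonomial_pair_ne_zero {v : Coord dims → K} {t : Fin 2 → Chart dims} :
    eval v (chartMonomial K t) ≠ 0 ↔ eval v (chartMonomial K fun _ : Fin 1 => t 0) ≠ 0 ∧
      eval v (chartMonomial K fun _ : Fin 1 => t 1) ≠ 0 := by
  rw [chartMonomial_pair, map_mul, mul_ne_zero_iff]

theorem exists_chart (p : Points K dims) :
    ∃ t : Fin 1 → Chart dims, eval (rep p) (chartMonomial K t) ≠ 0 := by
  choose a ha using exists_rep_ne_zero p
  exact ⟨fun _ => a, by simpa [chartMonomial, Finset.prod_eq_zero_iff] using ha⟩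

/-- A chart containing the point `p`. -/
def chartAt (p : Points K dims) : Fin 1 → Chart dims := (exists_chart p).choose

theorem eval_chartAt (p : Points K dims) : eval (rep p) (chartMonomial K (chartAt p)) ≠ 0 :=
  (exists_chart p).choose_spec

/-- The jets of a form of multidegree `(1, …, 1)` at the points of `S`. -/
def jetsOfForm (S : Finset (Points K dims)) : multilinearForms K dims →ₗ[K] (S → Jet K dims) :=
  LinearMap.pi fun p => (jet (rep p.1)).toLinearMap ∘ₗ Submodule.subtype _

theorem jetsOfForm_apply (S : Finset (Points K dims)) (L : multilinearForms K dims) (p : S) :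
    jetsOfForm S L p = jet (rep p.1) L.1 := rfl

/-- The jets at the points of `S` of a family of local sections of `𝒪(1, …, 1)`. -/
def jetsOfCochain (S : Finset (Points K dims)) :
    ((Fin 1 → Chart dims) → Frac K dims) →ₗ[K] (S → Jet K dims) :=
  LinearMap.pi fun p => germJet (rep p.1) ∘ₗ LinearMap.proj (chartAt p.1)

/-- The cochains of `𝒪(1, …, 1)` that are cocycles modulo the ideal sheaf of the double points. -/
def relativeCocycles (S : Finset (Points K dims)) :
    Submodule K ((Fin 1 → Chart dims) → Frac K dims) :=
  cochains ⊤ (fun _ => 1) 0 ⊓ (cochains (doublePointsIdeal S) (fun _ => 1) 1).comap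
    (cechDiff K dims 0)

/-- The possible jets at the points of `S` of sections of `𝒪(1, …, 1)`. -/
def jetSpace (S : Finset (Points K dims)) : Submodule K (S → Jet K dims) :=
  Submodule.pi Set.univ fun p => eulerSpace (rep p.1)

theorem germJet_mem_eulerSpace {q : ℕ} {t : Fin q → Chart dims} {f : Frac K dims}
    {v : Coord dims → K} (hf : f ∈ chartSections ⊤ (fun _ => 1) t)
    (hv : eval v (chartMonomial K t) ≠ 0) : germJet v f ∈ eulerSpace v := by
  obtain ⟨N, g, -, hd, he⟩ := hf
  have hN : eval v (chartMonomial K t ^ N) ≠ 0 := by rw [map_pow]; exact pow_ne_zero _ hv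
  rw [mem_eulerSpace]
  have h := hasEulerWeight_jet v hd
  rw [← germJet_mul hN he] at h
  refine h.of_mul (hasEulerWeight_jet v (chartMonomial_pow_isWeightedHomogeneous K t N)) ?_
    (by push_cast; ring)
  rwa [fst_jet]

theorem exists_section_jet {S : Finset (Points K dims)} (p : Points K dims) {α : Jet K dims}
    (hα : α ∈ eulerSpace (rep p)) (t : Fin 1 → Chart dims) :
    ∃ f ∈ chartSections (⊤ : Ideal (CoordRing K dims)) (fun _ => 1) t,
      (eval (rep p) (chartMonomial K t) ≠ 0 → germJet (rep p) f = α) ∧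
      ∀ q ∈ S, q ≠ p → eval (rep q) (chartMonomial K t) ≠ 0 → germJet (rep q) f = 0 := by
  by_cases hp : eval (rep p) (chartMonomial K t) = 0
  · exact ⟨0, zero_mem _, fun h => absurd hp h, by simp⟩
  obtain ⟨D, G, hG, hGp, hGq⟩ := exists_form_separating S p
  have hm := chartMonomial_pow_isWeightedHomogeneous K t D
  have hne : ∀ {q}, eval (rep q) (chartMonomial K t) ≠ 0 →
      eval (rep q) (chartMonomial K t ^ D) ≠ 0 := fun h => by
    rw [map_pow]; exact pow_ne_zero _ h
  obtain ⟨u, hu⟩ := isUnit_jet hGp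
  -- The section will be `L * G / m ^ D`, with `m` the chart monomial; the jet required of `L` is
  -- obtained by solving for jet `α` at `p`. The factor `G` kills the jets at the other points of
  -- `S`.
  obtain ⟨L, hL, hLj⟩ := exists_form_jet (exists_rep_ne_zero p)
    (α := α * jet (rep p) (chartMonomial K t ^ D) * (↑u⁻¹ : Jet K dims)) (by
      rw [mem_eulerSpace]
      refine HasEulerWeight.of_mul (β := jet (rep p) G) (c := 1 + D) ?_
        (hasEulerWeight_jet _ hG) (by rwa [fst_jet]) rfl
      rw [← hu, Units.inv_mul_cancel_right]
      refine (mem_eulerSpace.1 hα).mul ?_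
      simpa using hasEulerWeight_jet (rep p) hm)
  have hLG : jet (rep p) L * jet (rep p) G = α * jet (rep p) (chartMonomial K t ^ D) := by
    rw [hLj, ← hu, Units.inv_mul_cancel_right]
  have hm0 : algebraMap (CoordRing K dims) (Frac K dims) (chartMonomial K t ^ D) ≠ 0 := by
    rw [Ne, FaithfulSMul.algebraMap_eq_zero_iff]
    intro h
    exact hne hp (by rw [h, map_zero])
  have he := div_mul_cancel₀ (algebraMap (CoordRing K dims) (Frac K dims) (L * G)) hm0
  refine ⟨_, ⟨D, L * G, trivial, ?_, he⟩, fun _ => ?_, fun q hq hqp hqt => ?_⟩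
  · convert IsWeightedHomogeneous.mul hL hG using 1
    funext i
    simp
  · have h := germJet_mul (hne hp) he
    rw [map_mul (jet (rep p)), hLG] at h
    exact (isUnit_jet (hne hp)).mul_right_cancel h
  · have h := germJet_mul (hne hqt) he
    rw [map_mul (jet (rep q)), hGq q hq hqp, mul_zero] at h
    exact (isUnit_jet (hne hqt)).mul_left_eq_zero.1 h

theorem exists_cochain_jets {S : Finset (Points K dims)} {α : S → Jet K dims}
    (hα : α ∈ jetSpace S) : ∃ b ∈ cochains (⊤ : Ideal (CoordRing K dims)) (fun _ => 1) 0,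
      ∀ (p : S) t, eval (rep p.1) (chartMonomial K t) ≠ 0 → germJet (rep p.1) (b t) = α p := by
  choose f hf hfp hfq using fun p : S => exists_section_jet (S := S) p.1 (hα p trivial)
  refine ⟨fun t => ∑ p : S, f p t, fun t _ => sum_mem fun p _ => hf p t, fun p t hp => ?_⟩
  rw [map_sum, Finset.sum_eq_single p]
  · exact hfp p t hp
  · intro q _ hq
    exact hfq q t p.1 p.2 (fun h => hq (Subtype.ext h.symm)) hp
  · simp

theorem germJet_eq_of_mem {S : Finset (Points K dims)} {b : (Fin 1 → Chart dims) → Frac K dims}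
    (hb : b ∈ relativeCocycles S) {p : Points K dims} (hp : p ∈ S) {s t : Fin 1 → Chart dims}
    (hs : eval (rep p) (chartMonomial K s) ≠ 0) (ht : eval (rep p) (chartMonomial K t) ≠ 0) :
    germJet (rep p) (b s) = germJet (rep p) (b t) := by
  have hs' : (fun _ : Fin 1 => s 0) = s := by funext l; rw [Subsingleton.elim l 0]
  have ht' : (fun _ : Fin 1 => t 0) = t := by funext l; rw [Subsingleton.elim l 0]
  have h := germJet_eq_zero (hb.2 ![s 0, t 0] trivial) hp
    (eval_chartMonomial_pair_ne_zero.2 ⟨by simpa [hs'] using hs, by simpa [ht'] using ht⟩)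
  rw [cechDiff_zero_apply, map_sub, sub_eq_zero] at h
  simpa [hs', ht'] using h.symm

/-- Surjectivity holds because sections with prescribed jets exist on every chart; on overlaps their
differences have zero jets at `S`, hence lie in the ideal sheaf. -/
theorem map_jetsOfCochain (S : Finset (Points K dims)) :
    (relativeCocycles S).map (jetsOfCochain S) = jetSpace S := by
  ext α
  constructor
  · rintro ⟨b, hb, rfl⟩ p -
    exact germJet_mem_eulerSpace (hb.1 _ trivial) (eval_chartAt p.1)
  · intro hα
    obtain ⟨b, hb, h⟩ := exists_cochain_jets hα
    refine ⟨b, ⟨hb, fun t _ => ?_⟩, funext fun p => h p _ (eval_chartAt p.1)⟩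
    refine mem_chartSections_of_germJet (d := fun _ => 0) (cechDiff_mem_cochains hb t trivial)
      fun p hp hpt => ?_
    rw [eval_chartMonomial_pair_ne_zero] at hpt
    rw [cechDiff_zero_apply, map_sub, h ⟨p, hp⟩ _ hpt.1, h ⟨p, hp⟩ _ hpt.2, sub_self]

theorem mem_cochains_of_jets_eq_zero {S : Finset (Points K dims)}
    {b : (Fin 1 → Chart dims) → Frac K dims} (hb : b ∈ relativeCocycles S)
    (h : jetsOfCochain S b = 0) : b ∈ cochains (doublePointsIdeal S) (fun _ => 1) 0 := by
  intro t _
  refine mem_chartSections_of_germJet (d := fun _ => 0) (hb.1 t trivial) fun p hp hpt => ?_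
  rw [germJet_eq_of_mem hb hp hpt (eval_chartAt p)]
  exact congrFun h ⟨p, hp⟩

/-- Surjectivity is exactly `H¹(𝒪(1,…,1)) = 0`. -/
theorem map_cechDiff_relativeCocycles (S : Finset (Points K dims)) :
    (relativeCocycles S).map (cechDiff K dims 0) =
      cocycles (doublePointsIdeal S) (fun _ => 1) 1 := by
  ext c
  constructor
  · rintro ⟨b, hb, rfl⟩
    exact ⟨hb.2, cechDiff_one_zero b⟩
  · intro hc
    obtain ⟨b, hb, rfl⟩ := exists_cochain_of_cocycle (d := fun _ => 1)
      (c := c) ⟨fun t ht => chartSections_mono le_top _ t (hc.1 t ht), hc.2⟩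
    exact ⟨b, ⟨hb, hc.1⟩, rfl⟩

theorem cechDiff_const (f : Frac K dims) : cechDiff K dims 0 (fun _ => f) = 0 := by
  funext t
  rw [cechDiff_zero_apply, sub_self, Pi.zero_apply]

theorem const_mem_relativeCocycles (S : Finset (Points K dims)) (L : multilinearForms K dims) :
    (fun _ => algebraMap _ _ L.1) ∈ relativeCocycles S :=
  ⟨fun t _ => algebraMap_mem_chartSections Submodule.mem_top L.2 t, by
    rw [SetLike.mem_coe, Submodule.mem_comap, cechDiff_const]
    exact zero_mem _⟩

theorem jetsOfCochain_const (S : Finset (Points K dims)) (L : multilinearForms K dims) :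
    jetsOfCochain S (fun _ => algebraMap _ _ L.1) = jetsOfForm S L :=
  funext fun p => germJet_algebraMap (rep p.1) L.1

theorem exists_form_of_cechDiff_eq_zero {b : (Fin 1 → Chart dims) → Frac K dims}
    (hb : b ∈ cochains (⊤ : Ideal (CoordRing K dims)) (fun _ => 1) 0)
    (h : cechDiff K dims 0 b = 0) :
    ∃ L : multilinearForms K dims, b = fun _ => algebraMap _ _ L.1 := by
  have hc : ∀ s t, b s = b t := by
    intro s t
    have h1 := congrFun h ![t 0, s 0]
    rw [cechDiff_zero_apply, Pi.zero_apply, sub_eq_zero] at h1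
    have hs' : (fun _ : Fin 1 => s 0) = s := by funext l; rw [Subsingleton.elim l 0]
    have ht' : (fun _ : Fin 1 => t 0) = t := by funext l; rw [Subsingleton.elim l 0]
    simpa [hs', ht'] using h1
  let t₀ : Fin 1 → Chart dims := fun _ _ => 0
  obtain ⟨g, hg, he⟩ := exists_form_of_forall_mem (f := b t₀) (d := fun _ => 1)
    fun t => by rw [hc t₀ t]; exact hb t trivial
  exact ⟨⟨g, hg⟩, funext fun t => by rw [he, hc t t₀]⟩

/-- Two cochains of `𝒪(1,…,1)` with equal differential differ by a global form, and a relative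
cocycle with zero jets is a cochain of the ideal sheaf. Thus bounding in the ideal sheaf means
having the jets of a global form. -/
theorem cechDiff_mem_coboundaries_iff {S : Finset (Points K dims)}
    {b : (Fin 1 → Chart dims) → Frac K dims} (hb : b ∈ relativeCocycles S) :
    cechDiff K dims 0 b ∈ coboundaries (doublePointsIdeal S) (fun _ => 1) 1 ↔
      jetsOfCochain S b ∈ LinearMap.range (jetsOfForm S) := by
  constructor
  · rintro ⟨b', hb', he⟩
    obtain ⟨L, hL⟩ := exists_form_of_cechDiff_eq_zero (b := b - b')
      (sub_mem hb.1 fun t ht => chartSections_mono le_top _ t (hb' t ht))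
      (by rw [map_sub, he, sub_self])
    refine ⟨L, ?_⟩
    have h0 : jetsOfCochain S b' = 0 := funext fun p =>
      germJet_eq_zero (hb' _ trivial) p.2 (eval_chartAt p.1)
    rw [← jetsOfCochain_const, ← hL, map_sub, h0, sub_zero]
  · rintro ⟨L, hL⟩
    refine ⟨b - fun _ => algebraMap _ _ L.1, ?_, ?_⟩
    · refine mem_cochains_of_jets_eq_zero (sub_mem hb (const_mem_relativeCocycles S L)) ?_
      rw [map_sub, jetsOfCochain_const, hL, sub_self]
    · rw [map_sub, cechDiff_const, sub_zero]

theorem range_jetsOfForm_le (S : Finset (Points K dims)) :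
    LinearMap.range (jetsOfForm S) ≤ jetSpace S := by
  rintro _ ⟨L, rfl⟩ p -
  rw [SetLike.mem_coe, mem_eulerSpace]
  simpa [jetsOfForm_apply] using hasEulerWeight_jet (rep p.1) L.2

theorem finrank_jetSpace (S : Finset (Points K dims)) :
    Module.finrank K (jetSpace S) = S.card * (∑ i, dims i + 1) := by
  let e : jetSpace S ≃ₗ[K] ((p : S) → eulerSpace (rep p.1)) :=
    { toFun := fun α p => ⟨α.1 p, α.2 p trivial⟩
      map_add' := fun _ _ => rfl
      map_smul' := fun _ _ => rfl
      invFun := fun α => ⟨fun p => (α p).1, fun p _ => (α p).2⟩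
      left_inv := fun _ => rfl
      right_inv := fun _ => rfl }
  rw [e.finrank_eq, Module.finrank_pi_fintype,
    Finset.sum_congr rfl fun p _ => finrank_eulerSpace (exists_rep_ne_zero p.1)]
  simp

/-- The defect counts the conditions that double points at `S` fail to impose on forms of
multidegree `(1, …, 1)`. -/
theorem defect_add_finrank_range (S : Finset (Points K dims)) :
    defect S + Module.finrank K (LinearMap.range (jetsOfForm S)) =
      S.card * (∑ i, dims i + 1) := by
  have h1 : defect S = Module.finrank K
      (jetSpace S ⧸ (LinearMap.range (jetsOfForm S)).submoduleOf (jetSpace S)) := by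
    rw [defect, h]
    have h := finrank_quotient_map_eq_of_iff (relativeCocycles S) (cechDiff K dims 0)
      (jetsOfCochain S) (coboundaries (doublePointsIdeal S) (fun _ => 1) 1)
      (LinearMap.range (jetsOfForm S)) fun b hb => cechDiff_mem_coboundaries_iff hb
    rw [map_jetsOfCochain, map_cechDiff_relativeCocycles] at h
    exact h
  rw [h1, ← (Submodule.submoduleOfEquivOfLe (range_jetsOfForm_le S)).finrank_eq,
    Submodule.finrank_quotient_add_finrank, finrank_jetSpace]

theorem mem_ker_jetsOfForm {S : Finset (Points K dims)} {L : multilinearForms K dims} :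
    L ∈ LinearMap.ker (jetsOfForm S) ↔ L.1 ∈ doublePointsIdeal S := by
  rw [LinearMap.mem_ker, mem_doublePointsIdeal_iff_jet (d := fun _ => 0) L.2, funext_iff,
    Subtype.forall]
  rfl

theorem h_zero_eq (S : Finset (Points K dims)) :
    h 0 (doublePointsIdeal S) (fun _ => 1) =
      Module.finrank K (LinearMap.ker (jetsOfForm S)) := by
  let ι : multilinearForms K dims →ₗ[K] ((Fin 1 → Chart dims) → Frac K dims) :=
    LinearMap.pi fun _ => (IsScalarTower.toAlgHom K (CoordRing K dims) (Frac K dims)).toLinearMap ∘ₗ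
      Submodule.subtype _
  have hι : Function.Injective ι := by
    intro L L' hL
    exact Subtype.ext (FaithfulSMul.algebraMap_injective _ (Frac K dims)
      (congrFun hL fun _ _ => 0))
  have hm : (LinearMap.ker (jetsOfForm S)).map ι =
      cocycles (doublePointsIdeal S) (fun _ => 1) 0 := by
    ext c
    constructor
    · rintro ⟨L, hL, rfl⟩
      exact ⟨fun t _ => algebraMap_mem_chartSections (mem_ker_jetsOfForm.1 hL) L.2 t,
        cechDiff_const (algebraMap _ _ L.1)⟩
    · rintro ⟨hc, hz⟩
      obtain ⟨L, rfl⟩ := exists_form_of_cechDiff_eq_zero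
        (fun t ht => chartSections_mono le_top _ t (hc t ht)) hz
      refine ⟨L, ?_, rfl⟩
      rw [SetLike.mem_coe, LinearMap.mem_ker, ← jetsOfCochain_const]
      exact funext fun p => germJet_eq_zero (hc _ trivial) p.2 (eval_chartAt p.1)
  have hb : (coboundaries (doublePointsIdeal S) (fun _ => 1) 0).submoduleOf
      (cocycles (doublePointsIdeal S) (fun _ => 1) 0) = ⊥ := by
    rw [coboundaries, Submodule.submoduleOf, Submodule.comap_bot, Submodule.ker_subtype]
  refine (Submodule.quotEquivOfEqBot _ hb).finrank_eq.trans ?_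
  rw [← hm]
  exact (Submodule.equivMapOfInjective ι hι _).finrank_eq.symm

end Cohomology

/-! ### Upper bound for the space of forms, lower bound for the rank of the jet map. -/

section RankBounds

variable {K : Type u} [Field K]

theorem exists_dot_ne_zero {m : ℕ} {U : Submodule K (Fin m → K)} (hU : Module.finrank K U < m) :
    ∃ f x : Fin m → K, (∀ y ∈ U, ∑ j, f j * y j = 0) ∧ ∑ j, f j * x j = 1 := by
  obtain ⟨x, hx⟩ : ∃ x, x ∉ U := by
    by_contra! h
    rw [(Submodule.eq_top_iff'.2 h), finrank_top, Module.finrank_fin_fun] at hU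
    exact lt_irrefl _ hU
  obtain ⟨f, h⟩ := exists_dot_eq_one hx
  exact ⟨f, x, h⟩

theorem finrank_span_singleton_le {V : Type*} [AddCommGroup V] [Module K V] (x : V) :
    Module.finrank K (Submodule.span K {x}) ≤ 1 :=
  (finrank_span_le_card ({x} : Set V)).trans (by simp)

variable {k : ℕ} {dims : Fin k → ℕ}

theorem multilinearForms_le_span : multilinearForms K dims ≤
    Submodule.span K (Set.range fun t : Chart dims =>
      (monomial (chartExp fun _ : Fin 1 => t) 1 : CoordRing K dims)) := by
  intro G hG
  rw [G.as_sum]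
  refine sum_mem fun e he => ?_
  have h := isWeightedHomogeneous_iff.1 hG e he
  have hj : ∀ i, ∃ j, 1 ≤ e ⟨i, j⟩ := by
    intro i
    by_contra! hc
    have := h i
    rw [Finset.sum_eq_zero fun j _ => Nat.lt_one_iff.1 (hc j)] at this
    exact zero_ne_one this
  choose t ht using hj
  have hle : ∀ i j, chartExp (fun _ : Fin 1 => t) ⟨i, j⟩ ≤ e ⟨i, j⟩ := by
    intro i j
    by_cases hij : t i = j
    · subst hij
      exact (chartExp_le _ _).trans (ht i)
    · rw [chartExp_eq_zero _ fun _ => hij]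
      exact Nat.zero_le _
  have he' : e = chartExp fun _ : Fin 1 => t := by
    ext ⟨i, j⟩
    have := (Finset.sum_eq_sum_iff_of_le fun j _ => hle i j).1
      ((sum_chartExp (fun _ : Fin 1 => t) i).trans (h i).symm)
    exact (this j (Finset.mem_univ j)).symm
  rw [he', ← mul_one (coeff _ G), ← smul_eq_mul, ← smul_monomial]
  exact Submodule.smul_mem _ _ (Submodule.subset_span ⟨t, rfl⟩)

instance : Module.Finite K (multilinearForms K dims) :=
  haveI := Module.Finite.span_of_finite K (Set.finite_range fun t : Chart dims =>
    (monomial (chartExp fun _ : Fin 1 => t) 1 : CoordRing K dims))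
  Submodule.finiteDimensional_of_le multilinearForms_le_span

theorem finrank_multilinearForms_le :
    Module.finrank K (multilinearForms K dims) ≤ ∏ i, (dims i + 1) := by
  have := Module.Finite.span_of_finite K (Set.finite_range fun t : Chart dims =>
    (monomial (chartExp fun _ : Fin 1 => t) 1 : CoordRing K dims))
  refine (Submodule.finrank_mono multilinearForms_le_span).trans ?_
  refine (finrank_range_le_card _).trans ?_
  simp [Chart]

/-- Forms that are singular at one point of `S` and have independent jets at the points of `S`
raise the number of conditions imposed by the double points. -/
theorem add_le_finrank_range {S : Finset (Points K dims)} {p : Points K dims} (hp : p ∈ S) {m : ℕ}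
    (L : Fin m → multilinearForms K dims) (hL : ∀ l, jet (rep p) (L l).1 = 0)
    (hind : LinearIndependent K fun l => jetsOfForm S (L l)) :
    ∑ i, dims i + 1 + m ≤ Module.finrank K (LinearMap.range (jetsOfForm S)) := by
  -- Rank-nullity for the jet at `p`: its image is all of the `n+1` dimensional Euler space, and the
  -- jets of the given forms lie in its kernel.
  let π : LinearMap.range (jetsOfForm S) →ₗ[K] Jet K dims :=
    LinearMap.proj (⟨p, hp⟩ : S) ∘ₗ Submodule.subtype _
  have h := LinearMap.finrank_range_add_finrank_ker π
  have h1 : ∑ i, dims i + 1 ≤ Module.finrank K (LinearMap.range π) := by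
    rw [← finrank_eulerSpace (exists_rep_ne_zero p)]
    refine Submodule.finrank_mono fun α hα => ?_
    obtain ⟨F, hF, rfl⟩ := exists_form_jet (exists_rep_ne_zero p) hα
    exact ⟨⟨_, ⟨⟨F, hF⟩, rfl⟩⟩, rfl⟩
  have h2 : m ≤ Module.finrank K (LinearMap.ker π) := by
    let v : Fin m → LinearMap.ker π := fun l => ⟨⟨_, ⟨L l, rfl⟩⟩, hL l⟩
    have hv : LinearIndependent K v :=
      LinearIndependent.of_comp (Submodule.subtype _ ∘ₗ Submodule.subtype _) hind
    simpa using hv.fintype_card_le_finrank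
  omega

theorem exists_adapted_family (p q : Points K dims) :
    ∃ g : ∀ i : Fin k, Fin (dims i + 1) → K, (∀ i, blockVal (rep q) i (g i) = 1) ∧
      ∀ i, p i ≠ q i → blockVal (rep p) i (g i) = 0 := by
  have : ∀ i, ∃ f : Fin (dims i + 1) → K, blockVal (rep q) i f = 1 ∧
      (p i ≠ q i → blockVal (rep p) i f = 0) := by
    intro i
    by_cases h : p i = q i
    · obtain ⟨f, hf⟩ := exists_block_eq_one (exists_rep_ne_zero q i)
      exact ⟨f, hf, fun h' => absurd h h'⟩
    · obtain ⟨f, h0, h1⟩ := exists_block_separating (Ne.symm h)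
      exact ⟨f, h1, fun _ => h0⟩
  choose g h1 h0 using this
  exact ⟨g, h1, h0⟩

section Update

variable {v : Coord dims → K} {g : ∀ i : Fin k, Fin (dims i + 1) → K}
  {l : Fin k} {f : Fin (dims l + 1) → K}

theorem fst_jet_update (hf : blockVal v l f = 0) :
    (jet v (prodForm (Function.update g l f))).fst = 0 := by
  rw [fst_jet_prodForm]
  exact Finset.prod_eq_zero (Finset.mem_univ l) (by rw [Function.update_self, hf])

theorem snd_jet_update_self (hg : ∀ i, blockVal v i (g i) = 1) (j : Fin (dims l + 1)) :
    (jet v (prodForm (Function.update g l f))).snd ⟨l, j⟩ = f j := by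
  rw [snd_jet_prodForm, Function.update_self, Finset.prod_eq_one, mul_one]
  intro i hi
  rw [Function.update_of_ne (Finset.ne_of_mem_erase hi), hg]

theorem snd_jet_update_ne (hf : blockVal v l f = 0) {i : Fin k} (hi : i ≠ l)
    (j : Fin (dims i + 1)) :
    (jet v (prodForm (Function.update g l f))).snd ⟨i, j⟩ = 0 := by
  rw [snd_jet_prodForm, Finset.prod_eq_zero (i := l), mul_zero]
  · exact Finset.mem_erase.2 ⟨hi.symm, Finset.mem_univ _⟩
  · rw [Function.update_self, hf]

end Update

end RankBounds

/-! ### Extra conditions imposed by a second and a third point. -/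

section TwoPoints

variable {K : Type u} [Field K] {k : ℕ} {dims : Fin k → ℕ}

/-- The product of linear forms `f` as a form of multidegree `(1, …, 1)`. -/
def prodForm' (f : ∀ i : Fin k, Fin (dims i + 1) → K) : multilinearForms K dims :=
  ⟨prodForm f, prodForm_isWeightedHomogeneous f⟩

theorem linearIndependent_fin_two {V : Type*} [AddCommGroup V] [Module K V] {v : Fin 2 → V}
    (h : ∀ s t : K, s • v 0 + t • v 1 = 0 → s = 0 ∧ t = 0) : LinearIndependent K v := by
  rw [Fintype.linearIndependent_iff]
  intro g hg
  rw [Fin.sum_univ_two] at hg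
  have := h _ _ hg
  exact Fin.forall_fin_two.2 this

theorem linearIndependent_jets {S : Finset (Points K dims)} {q : Points K dims} (hq : q ∈ S)
    {m : ℕ} {L : Fin m → multilinearForms K dims}
    (h : LinearIndependent K fun l => jet (rep q) (L l).1) :
    LinearIndependent K fun l => jetsOfForm S (L l) :=
  LinearIndependent.of_comp (LinearMap.proj (⟨q, hq⟩ : S)) h

theorem blockVal_rep_congr {p q : Points K dims} {l : Fin k} (h : p l = q l)
    (f : Fin (dims l + 1) → K) : blockVal (rep p) l f = blockVal (rep q) l f := by
  simp only [blockVal, rep, h]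

theorem jet_update_eq_zero {v : Coord dims → K} {g : ∀ i : Fin k, Fin (dims i + 1) → K}
    {i l : Fin k} {f : Fin (dims l + 1) → K} (hil : i ≠ l) (hi : blockVal v i (g i) = 0)
    (hf : blockVal v l f = 0) : jet v (prodForm (Function.update g l f)) = 0 :=
  jet_prodForm_eq_zero hil (by rwa [Function.update_of_ne hil]) (by rwa [Function.update_self])

theorem exists_block_ne_zero (hd : ∀ i, 0 < dims i) (v : Coord dims → K) (l : Fin k) :
    ∃ f x : Fin (dims l + 1) → K, blockVal v l f = 0 ∧ ∑ j, f j * x j = 1 := by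
  obtain ⟨f, x, h, hx⟩ := exists_dot_ne_zero (U := Submodule.span K {fun j => v ⟨l, j⟩})
    ((finrank_span_singleton_le _).trans_lt (Nat.succ_lt_succ (hd l)))
  exact ⟨f, x, h _ (Submodule.mem_span_singleton_self _), hx⟩

theorem finrank_span_sup_span_le {V : Type*} [AddCommGroup V] [Module K V]
    [FiniteDimensional K V] (x y : V) :
    Module.finrank K (Submodule.span K {x} ⊔ Submodule.span K {y} : Submodule K V) ≤ 2 :=
  (Submodule.finrank_add_le_finrank_add_finrank _ _).trans
    (add_le_add (finrank_span_singleton_le x) (finrank_span_singleton_le y))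

theorem exists_block_ne_zero_pair {l : Fin k} (hd : 2 ≤ dims l) (v : Coord dims → K)
    (y : Fin (dims l + 1) → K) :
    ∃ f x : Fin (dims l + 1) → K, blockVal v l f = 0 ∧ ∑ j, f j * y j = 0 ∧
      ∑ j, f j * x j = 1 := by
  obtain ⟨f, x, h, hx⟩ := exists_dot_ne_zero
    (U := Submodule.span K {fun j => v ⟨l, j⟩} ⊔ Submodule.span K {y})
    ((finrank_span_sup_span_le _ _).trans_lt (Nat.lt_succ_of_le hd))
  exact ⟨f, x, h _ (Submodule.mem_sup_left (Submodule.mem_span_singleton_self _)),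
    h _ (Submodule.mem_sup_right (Submodule.mem_span_singleton_self _)), hx⟩

theorem eq_zero_of_smul_snd {m : ℕ} {f x : Fin m → K} (h1 : ∑ j, f j * x j = 1) {a : K}
    (h : ∀ j, a * f j = 0) : a = 0 := by
  rw [← mul_one a, ← h1, Finset.mul_sum]
  exact Finset.sum_eq_zero fun j _ => by rw [← mul_assoc, h j, zero_mul]

/-- Two points that differ in at least two factors. -/
theorem exists_forms_of_ne_of_ne (hd : ∀ i, 0 < dims i) (hn : 3 ≤ ∑ i, dims i)
    {p q : Points K dims} {i j : Fin k} (hij : i ≠ j) (hi : p i ≠ q i) (hj : p j ≠ q j) :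
    ∃ L : Fin 2 → multilinearForms K dims, (∀ l, jet (rep p) (L l).1 = 0) ∧
      LinearIndependent K fun l => jet (rep q) (L l).1 := by
  obtain ⟨g, hgq, hgp⟩ := exists_adapted_family p q
  obtain ⟨l, f, x, hfp, hfq, hx⟩ : ∃ (l : Fin k) (f x : Fin (dims l + 1) → K),
      jet (rep p) (prodForm (Function.update g l f)) = 0 ∧ blockVal (rep q) l f = 0 ∧
        ∑ a, f a * x a = 1 := by
    -- In a factor of dimension at least two a nonzero linear form can vanish at the coordinates of
    -- both `p` and `q`; the second zero at `p` comes from factor `b`.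
    have big : ∀ a b : Fin k, a ≠ b → p b ≠ q b → 2 ≤ dims a →
        ∃ (l : Fin k) (f x : Fin (dims l + 1) → K),
          jet (rep p) (prodForm (Function.update g l f)) = 0 ∧ blockVal (rep q) l f = 0 ∧
            ∑ a, f a * x a = 1 := by
      intro a b hab hb ha
      obtain ⟨f, x, h1, h2, h3⟩ := exists_block_ne_zero_pair ha (rep q) (fun c => rep p ⟨a, c⟩)
      exact ⟨a, f, x, jet_update_eq_zero hab.symm (hgp b hb) h2, h1, h3⟩
    -- With a third factor, modifying it leaves the two zeros at `p` in factors `i` and `j` intact.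
    -- Without one, `n ≥ 3` makes one of the two factors at least a plane.
    by_cases hl : ∃ l, l ≠ i ∧ l ≠ j
    · obtain ⟨l, hli, hlj⟩ := hl
      obtain ⟨f, x, h1, h2⟩ := exists_block_ne_zero hd (rep q) l
      refine ⟨l, f, x, jet_prodForm_eq_zero hij ?_ ?_, h1, h2⟩
      · rw [Function.update_of_ne hli.symm, hgp i hi]
      · rw [Function.update_of_ne hlj.symm, hgp j hj]
    · push Not at hl
      have hs : ∑ a, dims a = dims i + dims j :=
        Fintype.sum_eq_add i j hij fun a ha => absurd (hl a ha.1) ha.2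
      by_cases h2 : 2 ≤ dims i
      · exact big i j hij hj h2
      · exact big j i hij.symm hi (by omega)
  -- At `q` the first form has value one, while the second vanishes with nonzero gradient, so their
  -- jets are independent.
  refine ⟨![prodForm' g, prodForm' (Function.update g l f)], fun a => ?_, ?_⟩
  · fin_cases a
    · exact jet_prodForm_eq_zero hij (hgp i hi) (hgp j hj)
    · exact hfp
  · refine linearIndependent_fin_two fun s t hst => ?_
    change s • jet (rep q) (prodForm g) +
      t • jet (rep q) (prodForm (Function.update g l f)) = 0 at hst
    have hs : s = 0 := by
      have := congrArg TrivSqZeroExt.fst hst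
      simpa [fst_jet_update hfq, fst_jet_prodForm, hgq] using this
    subst hs
    refine ⟨rfl, eq_zero_of_smul_snd hx fun y => ?_⟩
    have := congrFun (congrArg TrivSqZeroExt.snd hst) ⟨l, y⟩
    simpa [snd_jet_update_self hgq] using this

/-- Two points that differ in exactly one factor. -/
theorem exists_forms_of_eq_of_ne (hd : ∀ i, 0 < dims i) {p q : Points K dims} {i j : Fin k}
    (hij : i ≠ j) (hi : p i ≠ q i) (h : ∀ l, l ≠ i → p l = q l) :
    ((∃ l, l ≠ i ∧ l ≠ j) ∨ 2 ≤ dims j → ∃ L : Fin 2 → multilinearForms K dims,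
        (∀ l, jet (rep p) (L l).1 = 0) ∧ LinearIndependent K fun l => jet (rep q) (L l).1) ∧
      ∃ L : Fin 1 → multilinearForms K dims,
        (∀ l, jet (rep p) (L l).1 = 0) ∧ LinearIndependent K fun l => jet (rep q) (L l).1 := by
  obtain ⟨g, hgq, hgp⟩ := exists_adapted_family p q
  have hzero : ∀ l (f : Fin (dims l + 1) → K), l ≠ i → blockVal (rep q) l f = 0 →
      jet (rep p) (prodForm (Function.update g l f)) = 0 := fun l f hl hf =>
    jet_update_eq_zero hl.symm (hgp i hi) (by rwa [blockVal_rep_congr (h l hl)])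
  obtain ⟨f, x, hf, hx⟩ := exists_block_ne_zero hd (rep q) j
  refine ⟨?_, fun _ => prodForm' (Function.update g j f), fun _ => hzero j f hij.symm hf, ?_⟩
  · rintro (⟨l, hli, hlj⟩ | h2)
    · obtain ⟨f', x', hf', hx'⟩ := exists_block_ne_zero hd (rep q) l
      refine ⟨![prodForm' (Function.update g j f), prodForm' (Function.update g l f')],
        Fin.forall_fin_two.2 ⟨hzero j f hij.symm hf, hzero l f' hli hf'⟩,
        linearIndependent_fin_two fun s t hst => ?_⟩
      change s • jet (rep q) (prodForm (Function.update g j f)) +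
        t • jet (rep q) (prodForm (Function.update g l f')) = 0 at hst
      constructor
      · refine eq_zero_of_smul_snd hx fun y => ?_
        have := congrFun (congrArg TrivSqZeroExt.snd hst) ⟨j, y⟩
        simpa [snd_jet_update_self hgq, snd_jet_update_ne hf' hlj.symm] using this
      · refine eq_zero_of_smul_snd hx' fun y => ?_
        have := congrFun (congrArg TrivSqZeroExt.snd hst) ⟨l, y⟩
        simpa [snd_jet_update_self hgq, snd_jet_update_ne hf hlj] using this
    -- Requiring `f'` to vanish on the vector `x`, where `f` has value one, makes `f` and `f'`
    -- independent.
    · obtain ⟨f', x', hf', hxf', hx'⟩ := exists_block_ne_zero_pair h2 (rep q) x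
      refine ⟨![prodForm' (Function.update g j f), prodForm' (Function.update g j f')],
        Fin.forall_fin_two.2 ⟨hzero j f hij.symm hf, hzero j f' hij.symm hf'⟩,
        linearIndependent_fin_two fun s t hst => ?_⟩
      change s • jet (rep q) (prodForm (Function.update g j f)) +
        t • jet (rep q) (prodForm (Function.update g j f')) = 0 at hst
      have key : ∀ y, s * f y + t * f' y = 0 := by
        intro y
        have := congrFun (congrArg TrivSqZeroExt.snd hst) ⟨j, y⟩
        simpa [snd_jet_update_self hgq] using this
      have hs : s = 0 := by
        have : ∑ y, (s * f y + t * f' y) * x y = 0 :=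
          Finset.sum_eq_zero fun y _ => by rw [key, zero_mul]
        simpa [add_mul, Finset.sum_add_distrib, mul_assoc, ← Finset.mul_sum, hx, hxf'] using this
      subst hs
      exact ⟨rfl, eq_zero_of_smul_snd hx' fun y => by simpa using key y⟩
  · refine linearIndependent_unique_iff.2 fun h0 => ?_
    have h1 : (1 : K) = 0 := eq_zero_of_smul_snd hx fun y => by
      rw [one_mul, ← snd_jet_update_self (v := rep q) hgq (f := f) y]
      exact congrFun (congrArg TrivSqZeroExt.snd h0) ⟨j, y⟩
    exact one_ne_zero h1

/-- Lower bounds for the number of conditions imposed by double points on forms of multidegree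
`(1, …, 1)`. -/
theorem le_finrank_range (hk : 2 ≤ k) (hd : ∀ i, 0 < dims i) (hn : 3 ≤ ∑ i, dims i)
    {S : Finset (Points K dims)} {p q : Points K dims} (hp : p ∈ S) (hq : q ∈ S) (hpq : p ≠ q) :
    ∑ i, dims i + 3 ≤ Module.finrank K (LinearMap.range (jetsOfForm S)) ∨
      (∑ i, dims i + 2 ≤ Module.finrank K (LinearMap.range (jetsOfForm S)) ∧
        ∃ i j, i ≠ j ∧ (∀ l, l = i ∨ l = j) ∧ dims j = 1 ∧ p i ≠ q i ∧ p j = q j) := by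
  obtain ⟨i, hi⟩ := Function.ne_iff.1 hpq
  by_cases hj : ∃ j, i ≠ j ∧ p j ≠ q j
  · obtain ⟨j, hij, hj⟩ := hj
    obtain ⟨L, hL, hind⟩ := exists_forms_of_ne_of_ne hd hn hij hi hj
    exact Or.inl (add_le_finrank_range hp L hL (linearIndependent_jets hq hind))
  · push Not at hj
    have : Nontrivial (Fin k) := Fin.nontrivial_iff_two_le.2 hk
    obtain ⟨j, hij⟩ := exists_ne i
    obtain ⟨h2, L, hL, hind⟩ := exists_forms_of_eq_of_ne hd hij.symm hi fun l hl => hj l hl.symm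
    by_cases h : (∃ l, l ≠ i ∧ l ≠ j) ∨ 2 ≤ dims j
    · obtain ⟨L, hL, hind⟩ := h2 h
      exact Or.inl (add_le_finrank_range hp L hL (linearIndependent_jets hq hind))
    · push Not at h
      refine Or.inr ⟨add_le_finrank_range hp L hL (linearIndependent_jets hq hind), i, j,
        hij.symm, fun l => ?_, ?_, hi, hj j hij.symm⟩
      · by_cases hl : l = i
        · exact Or.inl hl
        · exact Or.inr (h.1 l hl)
      · have := hd j
        omega

/-- Three points in a common `ℙ^{n_i} × {o}` whose projections to `ℙ^{n_i}` are not collinear. -/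
theorem le_finrank_range_of_notMem {S : Finset (Points K dims)} {p q s : Points K dims}
    (hp : p ∈ S) (hq : q ∈ S) (hs : s ∈ S) {i j : Fin k} (hij : i ≠ j)
    (hk : ∀ l, l = i ∨ l = j) (hd : ∀ i, 0 < dims i) (hi : p i ≠ q i) (hpj : p j = q j)
    (hspan : (s i).rep ∉ Submodule.span K {(p i).rep} ⊔ Submodule.span K {(q i).rep}) :
    ∑ i, dims i + 3 ≤ Module.finrank K (LinearMap.range (jetsOfForm S)) := by
  obtain ⟨a, ha, has⟩ := exists_dot_eq_one hspan
  have hap : blockVal (rep p) i a = 0 :=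
    ha _ (Submodule.mem_sup_left (Submodule.mem_span_singleton_self _))
  have haq : blockVal (rep q) i a = 0 :=
    ha _ (Submodule.mem_sup_right (Submodule.mem_span_singleton_self _))
  have has : blockVal (rep s) i a = 1 := has
  obtain ⟨b, hbp, hbq⟩ := exists_block_separating (Ne.symm hi)
  obtain ⟨f, x, hf, hx⟩ := exists_block_ne_zero hd (rep q) j
  let F : (Fin (dims i + 1) → K) → ∀ l : Fin k, Fin (dims l + 1) → K := fun y =>
    Function.update (Function.update 0 i y) j f
  have hFi : ∀ y, F y i = y := fun y => by
    simp only [F, Function.update_of_ne hij, Function.update_self]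
  have hFj : ∀ y, F y j = f := fun y => Function.update_self ..
  have hsnd : ∀ v y c, (jet v (prodForm (F y))).snd ⟨j, c⟩ = f c * blockVal v i y := by
    intro v y c
    have he : Finset.univ.erase j = {i} := by
      ext l
      rw [Finset.mem_erase, Finset.mem_singleton]
      refine ⟨fun h => (hk l).resolve_right h.1, ?_⟩
      rintro rfl
      exact ⟨hij, Finset.mem_univ _⟩
    rw [snd_jet_prodForm, he, Finset.prod_singleton, hFi, hFj]
  have hzero : ∀ (v : Points K dims) y, blockVal (rep v) i y = 0 → v j = q j →
      jet (rep v) (prodForm (F y)) = 0 := fun v y h1 h2 =>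
    jet_prodForm_eq_zero hij (by rwa [hFi]) (by rwa [hFj, blockVal_rep_congr h2])
  -- Both forms contain the factor `f` vanishing at the common point of factor `j`, and `a`, `b`
  -- vanish at `p`. At `q` only the form of `b` has nonzero jet, which isolates its coefficient; the
  -- jet at `s` then detects the form of `a`.
  refine add_le_finrank_range hp ![prodForm' (F b), prodForm' (F a)]
    (Fin.forall_fin_two.2 ⟨hzero p b hbp hpj, hzero p a hap hpj⟩)
    (linearIndependent_fin_two fun c d hcd => ?_)
  have hcd' : ∀ v : S, c • jet (rep v.1) (prodForm (F b)) + d • jet (rep v.1) (prodForm (F a)) = 0 :=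
    fun v => congrFun hcd v
  have hc : c = 0 := by
    refine eq_zero_of_smul_snd hx fun y => ?_
    have := congrFun (congrArg TrivSqZeroExt.snd (hcd' ⟨q, hq⟩)) ⟨j, y⟩
    simpa [hsnd, hbq, haq] using this
  subst hc
  refine ⟨rfl, eq_zero_of_smul_snd hx fun y => ?_⟩
  have := congrFun (congrArg TrivSqZeroExt.snd (hcd' ⟨s, hs⟩)) ⟨j, y⟩
  simpa [hsnd, has] using this

end TwoPoints

/-! ### The upper bound and the equality case. -/

section Maximum

variable {K : Type u} [Field K]

/-- On a single projective space there are at most `n+1` independent linear forms, and one double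
point already imposes `n+1` conditions, leaving no nonzero form. -/
theorem two_le_of_h_zero_pos {k : ℕ} (hk : 0 < k) {dims : Fin k → ℕ}
    {S : Finset (Points K dims)} {p : Points K dims} (hp : p ∈ S)
    (h0 : 0 < h 0 (doublePointsIdeal S) (fun _ => 1)) : 2 ≤ k := by
  by_contra hlt
  obtain rfl : k = 1 := by omega
  rw [h_zero_eq] at h0
  have h1 := add_le_finrank_range hp (m := 0) Fin.elim0 (fun l => l.elim0)
    linearIndependent_empty_type
  have h2 := LinearMap.finrank_range_add_finrank_ker (jetsOfForm S)
  have h3 := finrank_multilinearForms_le (K := K) (dims := dims)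
  simp only [Fin.sum_univ_one, Fin.prod_univ_one] at h1 h3
  omega

theorem sub_one_mul_add (n : ℕ) {r : ℕ} (hr : 2 ≤ r) :
    r * (n + 1) = (r - 1) * (n + 1) + (n + 1) := by
  obtain ⟨s, rfl⟩ : ∃ s, r = s + 1 := ⟨r - 1, by omega⟩
  rw [Nat.add_sub_cancel, Nat.succ_mul]

theorem exists_ne_mem_of_two_le {α : Type*} {S : Finset α} {r : ℕ} (hS : S.card = r) (hr : 2 ≤ r) :
    ∃ p ∈ S, ∃ q ∈ S, p ≠ q :=
  Finset.one_lt_card.1 (by omega)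

theorem defect_le {n r : ℕ} (hn : 3 ≤ n) (hr : 2 ≤ r) {P : Pair K} (hP : P ∈ E K n r) :
    defect P.S ≤ (r - 1) * (n + 1) - 1 := by
  obtain ⟨rfl, hS, h0, -⟩ := hP
  obtain ⟨p, hp, q, hq, hpq⟩ := exists_ne_mem_of_two_le hS hr
  have hk := two_le_of_h_zero_pos P.k_pos hp h0
  have hadd := defect_add_finrank_range P.S
  rw [hS, sub_one_mul_add _ hr] at hadd
  have := le_finrank_range hk P.dims_pos hn hp hq hpq
  omega

theorem isLinearExample_of_defect_eq {n r : ℕ} (hn : 3 ≤ n) (hr : 2 ≤ r) {P : Pair K}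
    (hP : P ∈ E K n r) (hδ : defect P.S = (r - 1) * (n + 1) - 1) : IsLinearExample n 1 P := by
  obtain ⟨rfl, hS, h0, hδ0⟩ := hP
  obtain ⟨p, hp, q, hq, hpq⟩ := exists_ne_mem_of_two_le hS hr
  have hk := two_le_of_h_zero_pos P.k_pos hp h0
  have hadd := defect_add_finrank_range P.S
  rw [hS, sub_one_mul_add _ hr] at hadd
  -- Positivity of the defect ensures that the subtraction in `hδ` is not truncated, so the rank is
  -- exactly `n + 2`.
  have hrank : ¬ ∑ i, P.dims i + 3 ≤ Module.finrank K (LinearMap.range (jetsOfForm P.S)) := by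
    omega
  obtain ⟨-, i, j, hij, hcov, hdj, hi, hj⟩ :=
    (le_finrank_range hk P.dims_pos hn hp hq hpq).resolve_left hrank
  have hsum : ∑ l, P.dims l = P.dims i + P.dims j :=
    Fintype.sum_eq_add i j hij fun l hl => by
      rcases hcov l with h | h
      exacts [absurd h hl.1, absurd h hl.2]
  have hk2 : P.k = 2 := by
    have : (Finset.univ : Finset (Fin P.k)) = {i, j} := by
      ext l
      simpa using hcov l
    rw [← Finset.card_fin P.k, this, Finset.card_pair hij]
  have hoj : ∀ s ∈ P.S, s j = p j := by
    intro s hs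
    by_cases hps : p = s
    · rw [hps]
    · obtain ⟨-, i', j', hij', -, hdj', -, hj'⟩ :=
        (le_finrank_range hk P.dims_pos hn hp hs hps).resolve_left hrank
      -- The factor shared by `p` and `s` is a line, whereas factor `i` has dimension `n - 1 ≥ 2`;
      -- so the shared factor is `j` for every `s`.
      rcases hcov j' with rfl | rfl
      · omega
      · exact hj'.symm
  have hmem : ∀ s ∈ P.S, (s i).submodule ≤ (p i).submodule ⊔ (q i).submodule := by
    intro s hs
    simp only [Projectivization.submodule_eq]
    rw [Submodule.span_singleton_le_iff_mem]
    by_contra hspan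
    exact hrank (le_finrank_range_of_notMem hp hq hs hij hcov P.dims_pos hi hj hspan)
  refine ⟨hk2, i, j, hij, by omega, hdj, (p i).submodule ⊔ (q i).submodule, p j, ?_,
    fun s hs => ⟨hmem s hs, hoj s hs⟩, ?_⟩
  · have h1 := Submodule.finrank_sup_add_finrank_inf_eq (p i).submodule (q i).submodule
    have h2 : (p i).submodule ⊓ (q i).submodule = ⊥ := by
      rw [Projectivization.submodule_eq (p i), Projectivization.submodule_eq (q i),
        ← disjoint_iff, Submodule.disjoint_span_singleton]
      exact fun hx => absurd hx (rep_block_ne_smul (Ne.symm hi))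
    rw [h2, finrank_bot, Projectivization.finrank_submodule,
      Projectivization.finrank_submodule] at h1
    exact h1
  · refine le_antisymm (iSup₂_le hmem) (sup_le ?_ ?_)
    · exact le_iSup₂_of_le p hp le_rfl
    · exact le_iSup₂_of_le q hq le_rfl

end Maximum

/-! ### Collinear points in a slice of `ℙ^{n-1} × ℙ¹` attain the bound. -/

section Example

variable (K : Type u) [Field K]

/-- The dimensions of the factors of `ℙ^{n-1} × ℙ^1`. -/
abbrev lineDims (n : ℕ) : Fin 2 → ℕ := ![n - 1, 1]

/-- Coordinates of the point `([1 : a : 0 : ⋯ : 0], [1 : 0])`. -/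
def lineVec (n : ℕ) (a : K) (i : Fin 2) : Fin (lineDims n i + 1) → K := fun j =>
  if (j : ℕ) = 0 then 1 else if i = 0 ∧ (j : ℕ) = 1 then a else 0

theorem lineVec_ne_zero (n : ℕ) (a : K) (i : Fin 2) : lineVec K n a i ≠ 0 := fun h0 =>
  one_ne_zero (α := K) (by simpa [lineVec] using congrFun h0 0)

/-- The point `([1 : a : 0 : ⋯ : 0], [1 : 0])` of `ℙ^{n-1} × ℙ^1`. -/
def linePoint (n : ℕ) (a : K) : Points K (lineDims n) := fun i =>
  Projectivization.mk K (lineVec K n a i) (lineVec_ne_zero K n a i)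

theorem linePoint_injective {n : ℕ} (hn : 3 ≤ n) : Function.Injective (linePoint K n) := by
  intro a b hab
  have h := congrFun hab 0
  rw [linePoint, linePoint, Projectivization.mk_eq_mk_iff'] at h
  obtain ⟨c, hc⟩ := h
  have hd : 1 < lineDims n 0 + 1 := by
    simp
    omega
  have h0 : c * lineVec K n b 0 0 = lineVec K n a 0 0 := congrFun hc 0
  have h1 : c * lineVec K n b 0 ⟨1, hd⟩ = lineVec K n a 0 ⟨1, hd⟩ := congrFun hc ⟨1, hd⟩
  simp only [lineVec, Fin.val_zero, one_ne_zero, and_self, if_true, if_false, mul_one] at h0 h1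
  rw [← h1, h0, one_mul]

variable {K}

theorem X_mem_pointIdeal_linePoint {n : ℕ} {a : K} {c : Coord (lineDims n)}
    (hc : lineVec K n a c.1 c.2 = 0) : (X c : CoordRing K (lineDims n)) ∈ pointIdeal (linePoint K n a) := by
  apply X_mem_pointIdeal
  obtain ⟨u, hu⟩ := Projectivization.exists_smul_eq_mk_rep K _ (lineVec_ne_zero K n a c.1)
  have := congrFun hu c.2
  rw [rep, linePoint, ← this, Pi.smul_apply, hc, smul_zero]

/-- The coordinates of index at least 2 on `ℙ^{n-1}` and the coordinate of index 1 on `ℙ¹` all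
vanish on the slice containing `S`. Products of one of each kind lie in the squared point ideals and
are distinct monomials. -/
theorem linePoint_form_mem {n : ℕ} (hn : 3 ≤ n) {S : Finset (Points K (lineDims n))}
    (hS : ∀ p ∈ S, ∃ a, linePoint K n a = p) :
    n - 2 ≤ Module.finrank K (LinearMap.ker (jetsOfForm S)) := by
  let c : Fin (n - 2) → Coord (lineDims n) := fun l => ⟨0, ⟨l + 2, by simp; omega⟩⟩
  let c₁ : Coord (lineDims n) := ⟨1, ⟨1, by simp⟩⟩
  let F : Fin (n - 2) → CoordRing K (lineDims n) := fun l => X (c l) * X c₁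
  have hF : ∀ l, F l ∈ multilinearForms K (lineDims n) := by
    intro l
    rw [mem_weightedHomogeneousSubmodule]
    convert (isWeightedHomogeneous_X K multidegree (c l)).mul
      (isWeightedHomogeneous_X K multidegree c₁) using 1
    funext i
    fin_cases i <;> simp [multidegree, c, c₁]
  have hk : ∀ l, (⟨F l, hF l⟩ : multilinearForms K (lineDims n)) ∈
      LinearMap.ker (jetsOfForm S) := by
    intro l
    rw [mem_ker_jetsOfForm, mem_doublePointsIdeal_iff]
    intro p hp
    obtain ⟨a, rfl⟩ := hS p hp
    rw [pow_two]
    exact Ideal.mul_mem_mul (X_mem_pointIdeal_linePoint (by simp [lineVec, c]))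
      (X_mem_pointIdeal_linePoint (by simp [lineVec, c₁]))
  have hind : LinearIndependent K F := by
    have h1 := (basisMonomials (Coord (lineDims n)) K).linearIndependent.comp
      (fun l : Fin (n - 2) => Finsupp.single (c l) 1 + Finsupp.single c₁ 1) (by
        intro l l' hl
        have := Finsupp.single_left_injective one_ne_zero (add_right_cancel hl)
        have h2 := congrArg (fun x : Coord (lineDims n) => (x.2 : ℕ)) this
        exact Fin.ext (Nat.add_right_cancel h2))
    have hFb : F = basisMonomials (Coord (lineDims n)) K ∘
        fun l => Finsupp.single (c l) 1 + Finsupp.single c₁ 1 := by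
      funext l
      simp [F, X, monomial_mul]
    rw [hFb]
    exact h1
  let v : Fin (n - 2) → LinearMap.ker (jetsOfForm S) := fun l => ⟨⟨F l, hF l⟩, hk l⟩
  have hv : LinearIndependent K v :=
    LinearIndependent.of_comp (Submodule.subtype _ ∘ₗ Submodule.subtype _) hind
  simpa using hv.fintype_card_le_finrank

theorem mem_defects [CharZero K] {n r : ℕ} (hn : 3 ≤ n) (hr : 2 ≤ r) :
    (r - 1) * (n + 1) - 1 ∈ defects K n r := by
  -- Characteristic zero makes the parameters `0, …, r - 1` distinct in `K`.
  let S : Finset (Points K (lineDims n)) := (Finset.range r).map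
    ⟨fun m : ℕ => linePoint K n (m : K), (linePoint_injective K hn).comp Nat.cast_injective⟩
  have hS : S.card = r := by simp [S]
  have hker := linePoint_form_mem hn (S := S) (by
    intro p hp
    obtain ⟨m, -, rfl⟩ := Finset.mem_map.1 hp
    exact ⟨m, rfl⟩)
  have hsum : ∑ i, lineDims n i = n := by
    simp
    omega
  have hdim := finrank_multilinearForms_le (K := K) (dims := lineDims n)
  have hpos : ∀ i, 0 < lineDims n i := by
    intro i
    fin_cases i
    · simp; omega
    · simp
  obtain ⟨p, hp, q, hq, hpq⟩ := exists_ne_mem_of_two_le hS hr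
  have hlow := le_finrank_range le_rfl hpos (hsum.symm ▸ hn) hp hq hpq
  have hnull := LinearMap.finrank_range_add_finrank_ker (jetsOfForm S)
  have hadd := defect_add_finrank_range S
  rw [hS, hsum, sub_one_mul_add _ hr] at hadd
  rw [hsum] at hlow
  simp only [Fin.prod_univ_two, Matrix.cons_val_zero, Matrix.cons_val_one] at hdim
  -- The rank is squeezed to `n + 2` between `hlow` and `2 * n - (n - 2)`; this estimate then makes
  -- the resulting defect positive.
  have hprod : n + 1 ≤ (r - 1) * (n + 1) := Nat.le_mul_of_pos_left _ (by omega)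
  refine ⟨⟨2, two_pos, lineDims n, hpos, S⟩, ⟨hsum, hS, ?_, ?_⟩, ?_⟩
  · rw [h_zero_eq]
    change 0 < Module.finrank K (LinearMap.ker (jetsOfForm S))
    omega
  · change 0 < defect S
    omega
  · change defect S = _
    omega

end Example

end Terracini

end

theorem mainTheorem4 (K : Type*) [Field K] [IsAlgClosed K] [CharZero K]
    (n r : ℕ) (hn : 3 ≤ n) (hr : 2 ≤ r) :
    IsGreatest (Terracini.defects K n r) (Terracini.δ₁ K n r) ∧
    Terracini.δ₁ K n r = (r - 1) * (n + 1) - 1 ∧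
    ∀ P ∈ Terracini.E K n r, Terracini.defect P.S = Terracini.δ₁ K n r →
      Terracini.IsLinearExample n 1 P := by
  have hmax : IsGreatest (Terracini.defects K n r) ((r - 1) * (n + 1) - 1) :=
    ⟨Terracini.mem_defects hn hr, fun _ ⟨_, hP, hδ⟩ => hδ ▸ Terracini.defect_le hn hr hP⟩
  have hδ : Terracini.δ₁ K n r = (r - 1) * (n + 1) - 1 := hmax.csSup_eq
  rw [hδ]
  exact ⟨hmax, rfl, fun P hP h => Terracini.isLinearExample_of_defect_eq hn hr hP h⟩
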